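/- Notation. For $\tau\in\mathbb C$ with $\operatorname{Im}\tau>0$ and $x\in\mathbb C$ put $q^x=e^{2\pi i\tau x}$, and let $\eta(\tau)=q^{1/24}\prod_{n\ge1}(1-q^n)$. For $m>0$, $k\in\mathbb R$, $z\in\mathbb C$ let $$\theta^{(\pm)}_{k,m}(\tau,z)=\sum_{j\in\mathbb Z}(\pm1)^j e^{2\pi i m(j+\frac{k}{2m})z}\,q^{m(j+\frac{k}{2m})^2},\qquad \theta_{k,m}=\theta^{(+)}_{k,m},$$ and let $\Phi^{[m,s]}=\Phi_1^{[m,s]}-\Phi_2^{[m,s]}$, where $$\Phi_1^{[m,s]}(\tau,z_1,z_2,t)=e^{-2\pi i m t}\sum_{j\in\mathbb Z}\frac{e^{2\pi i m j(z_1+z_2)+2\pi i s z_1}\,q^{mj^2+sj}}{1-e^{2\pi i z_1}q^j},\qquad \Phi_2^{[m,s]}(\tau,z_1,z_2,t)=e^{-2\pi i m t}\sum_{j\in\mathbb Z}\frac{e^{-2\pi i m j(z_1+z_2)-2\pi i s z_2}\,q^{mj^2+sj}}{1-e^{-2\pi i z_2}q^j}.$$ For an integer $m\ge1$ and $c,s\in\mathbb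 R$ put $$A_{m}(c,s)=\sum_{j=1}^{\infty}\sum_{r=1}^{j}\sum_{\substack{1\le k\le m-1\\ k\ \mathrm{odd}}}(-1)^j q^{j^2-\frac{1}{4m}(2mr-k)^2}\Big\{q^{(j+c)(2mr-k)}e^{\frac{\pi i}{2}(2mr+k)}+q^{(j-c)(2mr-k)}e^{\frac{\pi i}{2}(2mr-k)}\Big\}\big[\theta_{k+s,m}-\theta_{-(k+s),m}\big](\tau,z),$$ $$B_{m}(c,s)=\sum_{j=1}^{\infty}\sum_{r=0}^{j-1}\sum_{\substack{1\le k\le m-1\\ k\ \mathrm{odd}}}(-1)^j q^{j^2-\frac{1}{4m}(2mr+k)^2}\Big\{q^{(j+c)(2mr+k)}e^{\frac{\pi i}{2}(2mr-k)}+q^{(j-c)(2mr+k)}e^{\frac{\pi i}{2}(2mr+k)}\Big\}\big[\theta_{k+s,m}-\theta_{-(k+s),m}\big](\tau,z).$$ Proposition. Let $m\ge1$ and $p\ge0$ be integers, let $\operatorname{Im}\tau>0$, and let $z\in\mathbb C$ be such that neither $z+\frac\tau2-\frac12$ nor $z-\frac\tau2+\frac12$ lies in $\mathbb Z+2\tau\mathbb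 Z$. 1) The series $A_m(p+\frac14,0)$ and $B_m(p+\frac14,0)$ (as series in $j$) converge absolutely. Let $\pm$ be $+$ if $m$ is odd and $-$ if $m$ is even, put $D=\theta^{(\pm)}_{m(2p+\frac12),m+1}(\tau,0)$, and, if $m$ is even, assume $D\ne0$. Then $$\Phi^{[\frac m2,\frac12]}\Big(2\tau,\,z+\frac\tau2-\frac12,\,z-\frac\tau2+\frac12,\,\frac\tau8\Big) =-i(-1)^{mp}\frac{\eta(2\tau)^3}{D}\left\{\frac{\theta_{2p+\frac12,m+1}(\tau,z)}{\theta_{-\frac12,1}(\tau,z)}-\frac{\theta_{-2p-\frac12,m+1}(\tau,z)}{\theta_{\frac12,1}(\tau,z)}\right\}$$ $$+(-1)^{mp}\frac{q^{-\frac{m}{m+1}(p+\frac14)^2}}{D}\,A_m(p+\tfrac14,0)-(-1)^{mp}\frac{q^{-\frac{m}{m+1}(p+\frac14)^2}}{D}\,B_m(p+\tfrac14,0) -i\sum_{k=1}^{pm}(-1)^k q^{-\frac1m(k-\frac12+\frac m4)^2}\big[\theta_{2k-1,m}-\theta_{-(2k-1),m}\big](\tau,z).$$ 2) Let $m$ be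 odd and put $D'=\theta_{m(2p-\frac12),m+1}(\tau,0)$. Then the series $A_m(p-\frac14,m)$ and $B_m(p-\frac14,m)$ (as series in $j$) converge absolutely, and $$\Phi^{[\frac m2,0]}\Big(2\tau,\,z+\frac\tau2-\frac12,\,z-\frac\tau2+\frac12,\,\frac\tau8\Big) =-i(-1)^{mp}e^{-\frac{\pi i m}{2}}\frac{\eta(2\tau)^3}{D'}\left[\frac{\theta_{2p-\frac12+m+1,m+1}(\tau,z)}{\theta_{-\frac12,1}(\tau,z)}-\frac{\theta_{-(2p-\frac12+m+1),m+1}(\tau,z)}{\theta_{\frac12,1}(\tau,z)}\right]$$ $$+(-1)^{mp}e^{-\frac{\pi i m}{2}}\frac{q^{-\frac{m}{m+1}(p-\frac14)^2}}{D'}\,A_m(p-\tfrac14,m)-(-1)^{mp}e^{-\frac{\pi i m}{2}}\frac{q^{-\frac{m}{m+1}(p-\frac14)^2}}{D'}\,B_m(p-\tfrac14,m)$$ $$+(-1)^{mp}\sum_{k=1}^{\frac{m-1}{2}}(-1)^k q^{-m(p+\frac14-\frac km)^2}\big[\theta_{2k,m}-\theta_{-2k,m}\big](\tau,z) +\sum_{k=1}^{pm}(-1)^k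 q^{-\frac1m(k+\frac m4)^2}\big[\theta_{2k,m}-\theta_{-2k,m}\big](\tau,z).$$ -/

import Mathlib

noncomputable section

namespace MockTheta

open Complex

/-- The power `q ^ x`, where `q = exp (2 π i τ)`; it always means `exp (2 π i τ x)`. -/
def qPow (τ x : ℂ) : ℂ := exp (2 * Real.pi * I * τ * x)

/-- The signed Jacobi theta function
`θ^{(ε)}_{k,m}(τ, z) = ∑_{j ∈ ℤ} ε^j e^{2πi m (j + k/(2m)) z} q^{m (j + k/(2m))²}`, `ε = ±1`. -/
def signedTheta (ε : ℤˣ) (k m τ z : ℂ) : ℂ :=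
  ∑' j : ℤ, (((ε ^ j : ℤˣ) : ℤ) : ℂ) * exp (2 * Real.pi * I * m * (j + k / (2 * m)) * z) *
    qPow τ (m * (j + k / (2 * m)) ^ 2)

/-- The Jacobi theta function `θ_{k,m} = θ^{(+)}_{k,m}`. -/
def theta (k m τ z : ℂ) : ℂ := signedTheta 1 k m τ z

/-- The difference `[θ_{k,m} - θ_{-k,m}](τ, z)`. -/
def thetaDiff (k m τ z : ℂ) : ℂ := theta k m τ z - theta (-k) m τ z

/-- `Φ₁^{[m,s]}(τ, z₁, z₂, t)`. -/
def Phi₁ (m s τ z₁ z₂ t : ℂ) : ℂ :=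
  exp (-2 * Real.pi * I * m * t) *
    ∑' j : ℤ, exp (2 * Real.pi * I * m * j * (z₁ + z₂) + 2 * Real.pi * I * s * z₁) *
      qPow τ (m * j ^ 2 + s * j) / (1 - exp (2 * Real.pi * I * z₁) * qPow τ j)

/-- `Φ₂^{[m,s]}(τ, z₁, z₂, t)`. -/
def Phi₂ (m s τ z₁ z₂ t : ℂ) : ℂ :=
  exp (-2 * Real.pi * I * m * t) *
    ∑' j : ℤ, exp (-2 * Real.pi * I * m * j * (z₁ + z₂) - 2 * Real.pi * I * s * z₂) *
      qPow τ (m * j ^ 2 + s * j) / (1 - exp (-2 * Real.pi * I * z₂) * qPow τ j)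

/-- The Kac--Wakimoto mock theta function `Φ^{[m,s]} = Φ₁^{[m,s]} - Φ₂^{[m,s]}`. -/
def Phi (m s τ z₁ z₂ t : ℂ) : ℂ := Phi₁ m s τ z₁ z₂ t - Phi₂ m s τ z₁ z₂ t

/-- The sign `±`: it is `+` for odd `m` and `-` for even `m`. -/
def paritySign (m : ℕ) : ℤˣ := if Odd m then 1 else -1

/-- The odd integers `k` with `1 ≤ k ≤ m - 1`. -/
def oddBelow (m : ℕ) : Finset ℕ := (Finset.Icc 1 (m - 1)).filter Odd

/-- The `j`-th term of the first infinite series: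
`∑_{r=1}^{j} ∑_{k odd, 1 ≤ k ≤ m-1} (-1)^j q^{j² - (2mr-k)²/(4m)}
  {q^{(j+c)(2mr-k)} e^{πi(2mr+k)/2} + q^{(j-c)(2mr-k)} e^{πi(2mr-k)/2}}
  [θ_{k+s,m} - θ_{-(k+s),m}](τ, z)`. -/
def termA (m : ℕ) (c s τ z : ℂ) (j : ℕ) : ℂ :=
  ∑ r ∈ Finset.Icc 1 j, ∑ k ∈ oddBelow m,
    (-1) ^ j * qPow τ (j ^ 2 - (2 * m * r - k) ^ 2 / (4 * m)) *
      (qPow τ ((j + c) * (2 * m * r - k)) * exp (Real.pi * I / 2 * (2 * m * r + k)) +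
        qPow τ ((j - c) * (2 * m * r - k)) * exp (Real.pi * I / 2 * (2 * m * r - k))) *
      thetaDiff (k + s) m τ z

/-- The `j`-th term of the second infinite series:
`∑_{r=0}^{j-1} ∑_{k odd, 1 ≤ k ≤ m-1} (-1)^j q^{j² - (2mr+k)²/(4m)}
  {q^{(j+c)(2mr+k)} e^{πi(2mr-k)/2} + q^{(j-c)(2mr+k)} e^{πi(2mr+k)/2}}
  [θ_{k+s,m} - θ_{-(k+s),m}](τ, z)`. -/
def termB (m : ℕ) (c s τ z : ℂ) (j : ℕ) : ℂ :=
  ∑ r ∈ Finset.range j, ∑ k ∈ oddBelow m,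
    (-1) ^ j * qPow τ (j ^ 2 - (2 * m * r + k) ^ 2 / (4 * m)) *
      (qPow τ ((j + c) * (2 * m * r + k)) * exp (Real.pi * I / 2 * (2 * m * r - k)) +
        qPow τ ((j - c) * (2 * m * r + k)) * exp (Real.pi * I / 2 * (2 * m * r + k))) *
      thetaDiff (k + s) m τ z

end MockTheta

end

noncomputable section

namespace MockTheta

open Complex Filter Topology

/-! ### Finite `q`-series -/

/-! Write w = exp(2πiz), λ = j + 1/4 and ρ_j = w q^{2λ}. At the given arguments Φ₁ is, up to a
phase, the Appell-Lerch series G_b(z) = ∑_j q^{-mλ²} ρ_j^{mλ-b} / (1 + ρ_j) with b = m/4 - s, and Φ₂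
is the same series at -z (`Phi_eq_lerchDiff`). So the quantity to compute is G_b(z) - G_b(-z).

For b = mc - 1/2 this series sits inside a theta quotient. The function η(2τ)³/θ_{-1/2,1} has a
partial fraction expansion over the poles ρ_j = -1 with a free integer exponent a
(`tsum_etaQuotTerm`), obtained as a limit of the q-binomial theorem multiplied by finite partial
fractions (`thetaSeries_mul_tsum_recipTerm`). Multiplying by a theta function of degree m + 1, with
a = -l for its l-th term, gives an absolutely convergent double series in j and J = l - j whose
dependence on J in the numerator includes ρ_j^{mJ}. Division by 1 + ρ_j leaves the remainder
(-1)^{mJ}, for which the variables separate: the sum over J is the theta constant D and the sum over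
j is G_b. The quotient is a geometric sum; summed over j it becomes degree m theta functions with
indefinite coefficients (`quot_eq_lerchSum_add`). Antisymmetrizing in z and pairing odd numbers with
their reflections modulo 2m turns that part into A - B (`indefTerm_sub_neg`, `lerchDiff_eq`).

Finally G_b + G_{b+1} has no poles and is a multiple of one theta function (`lerchSum_add_one`).
Integer shifts of b therefore connect m/4 - s with mc - 1/2, c = p ± 1/4, at the cost of the finite
sums in the formulas. For odd m the division by D is legitimate by `theta_constant_ne_zero`. -/

/-- The finite product `(Q; Q)_n = ∏_{i=1}^{n} (1 - Q^i)`. -/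
def qFact (Q : ℂ) (n : ℕ) : ℂ := ∏ i ∈ Finset.range n, (1 - Q ^ (i + 1))

/-- The Gaussian binomial coefficient, as a quotient of finite products. -/
def gaussBinom (Q : ℂ) (M k : ℕ) : ℂ :=
  if k ≤ M then qFact Q M / (qFact Q k * qFact Q (M - k)) else 0

/-- The triangular number `n (n - 1) / 2` of an integer `n`. -/
def tri (n : ℤ) : ℤ := n * (n - 1) / 2

lemma two_mul_tri (n : ℤ) : 2 * tri n = n * (n - 1) := by
  unfold tri
  have : 2 ∣ n * (n - 1) := by
    have := Int.even_mul_pred_self n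
    exact this.two_dvd
  omega

lemma tri_add (a b : ℤ) : tri (a + b) = tri a + tri b + a * b := by
  have h1 := two_mul_tri (a + b)
  have h2 := two_mul_tri a
  have h3 := two_mul_tri b
  have : 2 * tri (a + b) = 2 * (tri a + tri b + a * b) := by linear_combination h1 - h2 - h3
  omega

lemma tri_zero : tri 0 = 0 := by simp [tri]

lemma tri_one : tri 1 = 0 := by simp [tri]

lemma tri_cast (n : ℤ) : ((tri n : ℤ) : ℂ) = n * (n - 1) / 2 := by
  have h : ((2 * tri n : ℤ) : ℂ) = ((n * (n - 1) : ℤ) : ℂ) := by rw [two_mul_tri]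
  push_cast at h
  linear_combination h / 2

lemma qFact_succ (Q : ℂ) (n : ℕ) : qFact Q (n + 1) = qFact Q n * (1 - Q ^ (n + 1)) := by
  simp [qFact, Finset.prod_range_succ]

lemma qFact_zero (Q : ℂ) : qFact Q 0 = 1 := by simp [qFact]

lemma one_sub_pow_ne_zero {Q : ℂ} (hQ : ‖Q‖ < 1) (n : ℕ) : 1 - Q ^ (n + 1) ≠ 0 := by
  intro h
  have h1 : ‖Q‖ ^ (n + 1) = 1 := by
    rw [← norm_pow, ← sub_eq_zero.mp h, norm_one]
  exact absurd h1 (pow_lt_one₀ (norm_nonneg _) hQ (by omega)).ne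

lemma qFact_ne_zero {Q : ℂ} (hQ : ‖Q‖ < 1) (n : ℕ) : qFact Q n ≠ 0 :=
  Finset.prod_ne_zero_iff.mpr fun _ _ => one_sub_pow_ne_zero hQ _

lemma gaussBinom_self {Q : ℂ} (hQ : ‖Q‖ < 1) (M : ℕ) : gaussBinom Q M M = 1 := by
  have := qFact_ne_zero hQ M
  simp [gaussBinom, qFact_zero, this]

lemma gaussBinom_zero {Q : ℂ} (hQ : ‖Q‖ < 1) (M : ℕ) : gaussBinom Q M 0 = 1 := by
  have := qFact_ne_zero hQ M
  simp [gaussBinom, qFact_zero, this]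

lemma gaussBinom_of_lt (Q : ℂ) {M k : ℕ} (h : M < k) : gaussBinom Q M k = 0 := by
  simp [gaussBinom, not_le.mpr h]

lemma gaussBinom_succ {Q : ℂ} (hQ : ‖Q‖ < 1) (M k : ℕ) :
    gaussBinom Q (M + 1) (k + 1) = gaussBinom Q M k + Q ^ (k + 1) * gaussBinom Q M (k + 1) := by
  rcases lt_trichotomy k M with h | h | h
  · obtain ⟨d, rfl⟩ := Nat.exists_eq_add_of_lt h
    have e1 : k + d + 1 + 1 - (k + 1) = d + 1 := by omega
    have e2 : k + d + 1 - k = d + 1 := by omega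
    have e3 : k + d + 1 - (k + 1) = d := by omega
    rw [gaussBinom, gaussBinom, gaussBinom, if_pos (by omega), if_pos (by omega),
      if_pos (by omega), e1, e2, e3, qFact_succ Q (k + d + 1), qFact_succ Q k, qFact_succ Q d]
    have h1 := qFact_ne_zero hQ k
    have h2 := qFact_ne_zero hQ d
    have h3 := one_sub_pow_ne_zero hQ k
    have h4 := one_sub_pow_ne_zero hQ d
    field_simp
    ring
  · subst h
    rw [gaussBinom_self hQ, gaussBinom_self hQ, gaussBinom_of_lt Q (Nat.lt_succ_self k)]
    ring
  · rw [gaussBinom_of_lt Q h, gaussBinom_of_lt Q (by omega), gaussBinom_of_lt Q (by omega)]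
    ring

lemma gaussBinom_succ' {Q : ℂ} (hQ : ‖Q‖ < 1) {M k : ℕ} (hk : k ≤ M) :
    gaussBinom Q (M + 1) (k + 1) =
      Q ^ (M - k) * gaussBinom Q M k + gaussBinom Q M (k + 1) := by
  rcases hk.lt_or_eq with h | h
  · obtain ⟨d, rfl⟩ := Nat.exists_eq_add_of_lt h
    have e1 : k + d + 1 + 1 - (k + 1) = d + 1 := by omega
    have e2 : k + d + 1 - k = d + 1 := by omega
    have e3 : k + d + 1 - (k + 1) = d := by omega
    rw [gaussBinom, gaussBinom, gaussBinom, if_pos (by omega), if_pos (by omega),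
      if_pos (by omega), e1, e2, e3, qFact_succ Q (k + d + 1), qFact_succ Q k, qFact_succ Q d]
    have h1 := qFact_ne_zero hQ k
    have h2 := qFact_ne_zero hQ d
    have h3 := one_sub_pow_ne_zero hQ k
    have h4 := one_sub_pow_ne_zero hQ d
    field_simp
    ring
  · subst h
    rw [gaussBinom_self hQ, gaussBinom_self hQ, gaussBinom_of_lt Q (Nat.lt_succ_self k)]
    simp

/-- The `q`-binomial theorem. -/
theorem prod_one_sub_eq_sum_gaussBinom {Q : ℂ} (hQ : ‖Q‖ < 1) (hQ0 : Q ≠ 0) (M : ℕ) (y : ℂ) :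
    ∏ i ∈ Finset.range M, (1 - y * Q ^ i) =
      ∑ k ∈ Finset.range (M + 1), (-1) ^ k * gaussBinom Q M k * Q ^ tri k * y ^ k := by
  induction M generalizing y with
  | zero => simp [gaussBinom_self hQ, tri_zero]
  | succ M ih =>
    have h1 : ∏ i ∈ Finset.range M, (1 - y * Q ^ (i + 1)) =
        ∏ i ∈ Finset.range M, (1 - y * Q * Q ^ i) := by
      refine Finset.prod_congr rfl fun i _ => ?_
      ring
    -- The factor i = 0 is split off; the remaining ones form the product at yQ, and Pascal's rule
    -- matches the coefficients.
    rw [Finset.prod_range_succ', h1, ih (y * Q), Finset.sum_range_succ' _ (M + 1)]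
    have h2 : ∀ k ∈ Finset.range (M + 1),
        (-1 : ℂ) ^ (k + 1) * gaussBinom Q (M + 1) (k + 1) * Q ^ tri ((k + 1 : ℕ) : ℤ) *
            y ^ (k + 1) =
          -y * ((-1) ^ k * gaussBinom Q M k * Q ^ tri k * (y * Q) ^ k) +
          (-1) ^ (k + 1) * gaussBinom Q M (k + 1) * Q ^ tri ((k + 1 : ℕ) : ℤ) *
            (y * Q) ^ (k + 1) := by
      intro k _
      have : Q ^ tri ((k + 1 : ℕ) : ℤ) = Q ^ tri k * Q ^ k := by
        push_cast
        rw [tri_add, tri_one, zpow_add₀ hQ0, zpow_add₀ hQ0]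
        simp
      rw [gaussBinom_succ hQ, this]
      ring
    rw [Finset.sum_congr rfl h2, Finset.sum_add_distrib, ← Finset.mul_sum]
    have h3 := Finset.sum_range_succ' (fun k : ℕ =>
      (-1 : ℂ) ^ k * gaussBinom Q M k * Q ^ tri k * (y * Q) ^ k) (M + 1)
    rw [Finset.sum_range_succ, gaussBinom_of_lt Q (Nat.lt_succ_self M)] at h3
    simp only [gaussBinom_zero hQ, tri_zero, Nat.cast_zero, zpow_zero, pow_zero] at h3 ⊢
    linear_combination h3

/-- At y = Q^{-a} the factor i = a of the q-binomial product vanishes. Passing from `tri k` to `tri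
(k + 1)` absorbs one power Q^k. -/
lemma sum_gaussBinom_eq_zero {Q : ℂ} (hQ : ‖Q‖ < 1) (hQ0 : Q ≠ 0) {M a : ℕ} (ha : a < M) :
    ∑ k ∈ Finset.range (M + 1), (-1) ^ k * gaussBinom Q M k * Q ^ tri (k + 1) *
      (Q ^ (-(a + 1 : ℤ))) ^ k = 0 := by
  have h := prod_one_sub_eq_sum_gaussBinom hQ hQ0 M (Q ^ (-(a : ℤ)))
  rw [Finset.prod_eq_zero (Finset.mem_range.mpr ha) (by
    rw [← zpow_natCast Q a, ← zpow_add₀ hQ0]; simp)] at h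
  rw [h]
  refine Finset.sum_congr rfl fun k _ => ?_
  have e : Q ^ tri (k + 1) * (Q ^ (-(a + 1 : ℤ))) ^ k = Q ^ tri k * (Q ^ (-(a : ℤ))) ^ k := by
    rw [tri_add, tri_one, ← zpow_natCast (Q ^ (-(a + 1 : ℤ))), ← zpow_natCast (Q ^ (-(a : ℤ))),
      ← zpow_mul, ← zpow_mul, ← zpow_add₀ hQ0, ← zpow_add₀ hQ0]
    congr 1
    ring
  linear_combination (-1) ^ k * gaussBinom Q M k * e

/-- The partial fraction expansion of `1 / ∏_{i=0}^{M} (1 - y Q^i)`. -/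
theorem sum_gaussBinom_div_one_sub {Q : ℂ} (hQ : ‖Q‖ < 1) (hQ0 : Q ≠ 0) (M : ℕ) (y : ℂ)
    (hy : ∀ i : ℕ, 1 - y * Q ^ i ≠ 0) :
    ∑ k ∈ Finset.range (M + 1), (-1) ^ k * gaussBinom Q M k * Q ^ tri (k + 1) /
        (1 - y * Q ^ k) = qFact Q M / ∏ i ∈ Finset.range (M + 1), (1 - y * Q ^ i) := by
  induction M generalizing y with
  | zero => simp [gaussBinom_self hQ, tri_one, qFact_zero]
  | succ M ih =>
    have hy' : ∀ i : ℕ, 1 - y * Q * Q ^ i ≠ 0 := fun i => by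
      have := hy (i + 1)
      rwa [pow_succ', ← mul_assoc] at this
    have h1 := ih y hy
    have h2 := ih (y * Q) hy'
    rw [Finset.sum_range_succ' _ (M + 1)]
    -- The second Pascal rule expresses the sum for M + 1 as the sum for M at y minus Q^{M+1} times
    -- the sum for M at yQ.
    have h3 : ∀ k ∈ Finset.range (M + 1),
        (-1 : ℂ) ^ (k + 1) * gaussBinom Q (M + 1) (k + 1) * Q ^ tri ((k + 1 : ℕ) + 1 : ℤ) /
            (1 - y * Q ^ (k + 1)) =
          -Q ^ (M + 1) * ((-1) ^ k * gaussBinom Q M k * Q ^ tri (k + 1) / (1 - y * Q * Q ^ k)) +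
          (-1) ^ (k + 1) * gaussBinom Q M (k + 1) * Q ^ tri ((k + 1 : ℕ) + 1 : ℤ) /
            (1 - y * Q ^ (k + 1)) := by
      intro k hk
      have hk' : k ≤ M := by simpa [Nat.lt_succ_iff] using hk
      have e : Q ^ tri ((k + 1 : ℕ) + 1 : ℤ) = Q ^ tri (k + 1) * Q ^ (k + 1) := by
        push_cast
        rw [tri_add (k + 1), tri_one, zpow_add₀ hQ0, zpow_add₀ hQ0]
        simp only [zpow_zero, mul_one]
        norm_cast
      have e2 : Q ^ (M + 1) = Q ^ (M - k) * Q ^ (k + 1) := by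
        rw [← pow_add]; congr 1; omega
      have e3 : y * Q * Q ^ k = y * Q ^ (k + 1) := by ring
      rw [gaussBinom_succ' hQ hk', e, e2, e3]
      ring
    rw [Finset.sum_congr rfl h3, Finset.sum_add_distrib, ← Finset.mul_sum, h2]
    have h4 := Finset.sum_range_succ' (fun k : ℕ =>
      (-1 : ℂ) ^ k * gaussBinom Q M k * Q ^ tri (k + 1) / (1 - y * Q ^ k)) (M + 1)
    rw [Finset.sum_range_succ, gaussBinom_of_lt Q (Nat.lt_succ_self M), h1] at h4
    have h5 : ∏ i ∈ Finset.range (M + 2), (1 - y * Q ^ i) =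
        (∏ i ∈ Finset.range (M + 1), (1 - y * Q ^ i)) * (1 - y * Q ^ (M + 1)) :=
      Finset.prod_range_succ _ _
    have h6 : ∏ i ∈ Finset.range (M + 2), (1 - y * Q ^ i) =
        (∏ i ∈ Finset.range (M + 1), (1 - y * Q * Q ^ i)) * (1 - y) := by
      rw [Finset.prod_range_succ']
      simp only [pow_zero, mul_one]
      congr 1
      exact Finset.prod_congr rfl fun i _ => by ring
    have n1 : ∏ i ∈ Finset.range (M + 1), (1 - y * Q ^ i) ≠ 0 :=
      Finset.prod_ne_zero_iff.mpr fun i _ => hy i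
    have n2 : ∏ i ∈ Finset.range (M + 1), (1 - y * Q * Q ^ i) ≠ 0 :=
      Finset.prod_ne_zero_iff.mpr fun i _ => hy' i
    have n3 := hy (M + 1)
    have n4 : 1 - y ≠ 0 := by simpa using hy 0
    -- Over the common product of M + 2 factors the induction closes by (1 - yQ^{M+1}) - Q^{M+1}(1 -
    -- y) = 1 - Q^{M+1}.
    have h7 : qFact Q M / ∏ i ∈ Finset.range (M + 1), (1 - y * Q ^ i) =
        qFact Q M * (1 - y * Q ^ (M + 1)) / ∏ i ∈ Finset.range (M + 2), (1 - y * Q ^ i) := by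
      rw [h5]; field_simp
    have h8 : qFact Q M / ∏ i ∈ Finset.range (M + 1), (1 - y * Q * Q ^ i) =
        qFact Q M * (1 - y) / ∏ i ∈ Finset.range (M + 2), (1 - y * Q ^ i) := by
      rw [h6]; field_simp
    rw [h7] at h4
    rw [h8, qFact_succ]
    simp only [gaussBinom_zero hQ] at h4 ⊢
    linear_combination -h4

/-- Variant of `sum_gaussBinom_div_one_sub` with a power in the numerators. -/
theorem sum_gaussBinom_mul_pow_div_one_sub {Q : ℂ} (hQ : ‖Q‖ < 1) (hQ0 : Q ≠ 0) {M : ℕ} {y : ℂ}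
    (hy0 : y ≠ 0) (hy : ∀ i : ℕ, 1 - y * Q ^ i ≠ 0) {a : ℕ} (ha : a ≤ M) :
    ∑ k ∈ Finset.range (M + 1), (-1) ^ k * gaussBinom Q M k * Q ^ tri (k + 1) *
        (y * Q ^ k) ^ (-(a : ℤ)) / (1 - y * Q ^ k) =
      qFact Q M / ∏ i ∈ Finset.range (M + 1), (1 - y * Q ^ i) := by
  induction a with
  | zero => simpa using sum_gaussBinom_div_one_sub hQ hQ0 M y hy
  | succ a ih =>
    rw [← ih (by omega), ← sub_eq_zero, ← Finset.sum_sub_distrib]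
    -- With X = yQ^k, X^{-a-1} - X^{-a} = X^{-a-1}(1 - X) cancels the denominator, so consecutive
    -- exponents differ by a vanishing sum.
    have h := sum_gaussBinom_eq_zero hQ hQ0 (show a < M by omega)
    have h' := congrArg (fun t => y ^ (-(a + 1 : ℤ)) * t) h
    simp only [mul_zero, Finset.mul_sum] at h'
    rw [← h']
    refine Finset.sum_congr rfl fun k _ => ?_
    have hX : y * Q ^ k ≠ 0 := mul_ne_zero hy0 (pow_ne_zero _ hQ0)
    have e1 : (y * Q ^ k) ^ (-(a : ℤ)) = (y * Q ^ k) ^ (-(a + 1 : ℤ)) * (y * Q ^ k) := by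
      rw [← zpow_add_one₀ hX]; congr 1; ring
    have e2 : (y * Q ^ k) ^ (-(a + 1 : ℤ)) = y ^ (-(a + 1 : ℤ)) * (Q ^ (-(a + 1 : ℤ))) ^ k := by
      rw [mul_zpow]
      congr 1
      rw [← zpow_natCast, ← zpow_natCast, ← zpow_mul, ← zpow_mul, mul_comm]
    have := hy k
    push_cast
    rw [e1, ← sub_div, e2, div_eq_iff this]
    ring

/-! ### Convergence -/

lemma summable_exp_quadratic {a : ℂ} (ha : a.re < 0) (b c : ℂ) :
    Summable fun n : ℤ => exp (a * n ^ 2 + b * n + c) := by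
  have hpi : (Real.pi : ℂ) ≠ 0 := by exact_mod_cast Real.pi_ne_zero
  have him : 0 < (a / (Real.pi * I)).im := by
    have : a / (Real.pi * I) = ((-(1 / Real.pi) : ℝ) : ℂ) * (a * I) := by
      push_cast
      field_simp
      linear_combination a * I_sq
    rw [this, im_ofReal_mul]
    simpa using mul_pos_of_neg_of_neg (neg_neg_of_pos (inv_pos.mpr Real.pi_pos)) ha
  have h := (summable_jacobiTheta₂_term_iff (b / (2 * Real.pi * I)) (a / (Real.pi * I))).mpr him
  refine (h.mul_right (exp c)).congr fun n => ?_
  rw [jacobiTheta₂_term, ← exp_add]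
  congr 1
  field_simp
  ring

lemma zpow_eq_exp_log {x : ℂ} (hx : x ≠ 0) (n : ℤ) : x ^ n = exp (n * log x) := by
  rw [exp_int_mul, exp_log hx]

lemma summable_zpow_tri_mul {Q : ℂ} (hQ : ‖Q‖ < 1) (hQ0 : Q ≠ 0) {y : ℂ} (hy : y ≠ 0) :
    Summable fun n : ℤ => Q ^ tri n * y ^ n := by
  have h : (log Q / 2).re < 0 := by
    have : Real.log ‖Q‖ < 0 := Real.log_neg (norm_pos_iff.mpr hQ0) hQ
    have e : (log Q / 2).re = Real.log ‖Q‖ / 2 := by simp [log_re]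
    rw [e]; linarith
  refine (summable_exp_quadratic h (log y - log Q / 2) 0).congr fun n => ?_
  rw [zpow_eq_exp_log hQ0, zpow_eq_exp_log hy, ← exp_add, tri_cast]
  congr 1
  ring

/-- The inverses tend to 1 as j → ∞ and to 0 as j → -∞. A vanishing denominator does no harm, since
its inverse is 0 by convention. -/
lemma exists_bound_inv_one_sub_zpow {Q : ℂ} (hQ : ‖Q‖ < 1) (hQ0 : Q ≠ 0) {x : ℂ} (hx : x ≠ 0) :
    ∃ C : ℝ, ∀ j : ℤ, ‖(1 - x * Q ^ j)⁻¹‖ ≤ C := by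
  have h0 := tendsto_pow_atTop_nhds_zero_of_norm_lt_one hQ
  have h1 : Tendsto (fun n : ℕ => ‖(1 - x * Q ^ n)⁻¹‖) atTop (𝓝 ‖(1 - x * 0)⁻¹‖) :=
    ((tendsto_const_nhds.sub (h0.const_mul x)).inv₀ (by simp)).norm
  have h2 : Tendsto (fun n : ℕ => ‖Q ^ n * (Q ^ n - x)⁻¹‖) atTop (𝓝 ‖0 * (0 - x)⁻¹‖) :=
    (h0.mul ((h0.sub tendsto_const_nhds).inv₀ (by simpa using hx))).norm
  obtain ⟨C₁, hC₁⟩ := h1.bddAbove_range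
  obtain ⟨C₂, hC₂⟩ := h2.bddAbove_range
  refine ⟨max C₁ C₂, fun j => ?_⟩
  obtain ⟨n, rfl | rfl⟩ := j.eq_nat_or_neg
  · exact le_max_of_le_left (hC₁ ⟨n, by simp⟩)
  · refine le_max_of_le_right ((le_of_eq ?_).trans (hC₂ ⟨n, rfl⟩))
    have hn : Q ^ n ≠ 0 := pow_ne_zero _ hQ0
    congr 1
    have : 1 - x * Q ^ (-(n : ℤ)) = (Q ^ n)⁻¹ * (Q ^ n - x) := by
      rw [zpow_neg, zpow_natCast]
      field_simp
    rw [this, mul_inv, inv_inv]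

lemma norm_neg_one_zpow (n : ℤ) : ‖(-1 : ℂ) ^ n‖ = 1 := by
  rw [norm_zpow]; simp

/-! ### The reciprocal of a theta series -/

/-- The theta series `∑_{n ∈ ℤ} (-1)^n Q^{n(n-1)/2} x^n`. -/
def thetaSeries (Q x : ℂ) : ℂ := ∑' n : ℤ, (-1) ^ n * Q ^ tri n * x ^ n

/-- The general term of the Appell-Lerch type expansion of the reciprocal theta series. -/
def recipTerm (Q x : ℂ) (a j : ℤ) : ℂ :=
  (-1) ^ j * Q ^ tri (j + 1) * (x * Q ^ j) ^ a / (1 - x * Q ^ j)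

/-- The infinite product `(Q; Q)_∞`. -/
def qFactInf (Q : ℂ) : ℂ := ∏' n : ℕ, (1 - Q ^ (n + 1))

lemma summable_norm_pow_succ {Q : ℂ} (hQ : ‖Q‖ < 1) :
    Summable fun n : ℕ => ‖-Q ^ (n + 1)‖ := by
  simp only [norm_neg, norm_pow]
  exact (summable_nat_add_iff 1).mpr (summable_geometric_of_lt_one (norm_nonneg _) hQ)

lemma tendsto_qFact {Q : ℂ} (hQ : ‖Q‖ < 1) : Tendsto (qFact Q) atTop (𝓝 (qFactInf Q)) := by
  have h := (multipliable_one_add_of_summable (summable_norm_pow_succ hQ)).hasProd.tendsto_prod_nat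
  simp only [← sub_eq_add_neg] at h
  exact h

lemma qFactInf_ne_zero {Q : ℂ} (hQ : ‖Q‖ < 1) : qFactInf Q ≠ 0 := by
  have h := tprod_one_add_ne_zero_of_summable (f := fun n : ℕ => -Q ^ (n + 1))
    (fun i => by simpa [← sub_eq_add_neg] using one_sub_pow_ne_zero hQ i)
    (summable_norm_pow_succ hQ)
  simpa [qFactInf, ← sub_eq_add_neg] using h

/-- The central Gaussian binomial coefficients `[2N, N + n]`, with integer `n`. -/
def centralGauss (Q : ℂ) (N : ℕ) (n : ℤ) : ℂ :=
  if -(N : ℤ) ≤ n then gaussBinom Q (2 * N) (N + n).toNat else 0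

/-- The products (Q; Q)_n converge to a nonzero limit, so they and their inverses are bounded.
Uniformity in both indices is what dominated convergence needs. -/
lemma exists_bound_gaussBinom {Q : ℂ} (hQ : ‖Q‖ < 1) :
    ∃ C : ℝ, ∀ M k, ‖gaussBinom Q M k‖ ≤ C := by
  have h := tendsto_qFact hQ
  obtain ⟨A, hA⟩ := h.norm.bddAbove_range
  obtain ⟨B, hB⟩ := (h.inv₀ (qFactInf_ne_zero hQ)).norm.bddAbove_range
  have hA' : ∀ n, ‖qFact Q n‖ ≤ A := fun n => hA ⟨n, rfl⟩
  have hB' : ∀ n, ‖(qFact Q n)⁻¹‖ ≤ B := fun n => hB ⟨n, rfl⟩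
  have hA0 : 0 ≤ A := (norm_nonneg _).trans (hA' 0)
  have hB0 : 0 ≤ B := (norm_nonneg _).trans (hB' 0)
  refine ⟨A * (B * B), fun M k => ?_⟩
  unfold gaussBinom
  split_ifs
  · rw [div_eq_mul_inv, mul_inv, norm_mul, norm_mul]
    exact mul_le_mul (hA' _) (mul_le_mul (hB' _) (hB' _) (norm_nonneg _) hB0) (by positivity) hA0
  · simpa using by positivity

lemma exists_bound_centralGauss {Q : ℂ} (hQ : ‖Q‖ < 1) :
    ∃ C : ℝ, 0 ≤ C ∧ ∀ N n, ‖centralGauss Q N n‖ ≤ C := by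
  obtain ⟨C, hC⟩ := exists_bound_gaussBinom hQ
  have hC0 : 0 ≤ C := (norm_nonneg _).trans (hC 0 0)
  refine ⟨C, hC0, fun N n => ?_⟩
  unfold centralGauss
  split_ifs
  · exact hC _ _
  · simpa using hC0

lemma tendsto_centralGauss {Q : ℂ} (hQ : ‖Q‖ < 1) (n : ℤ) :
    Tendsto (fun N => centralGauss Q N n) atTop (𝓝 (qFactInf Q)⁻¹) := by
  have h := tendsto_qFact hQ
  have hE := qFactInf_ne_zero hQ
  have h1 : Tendsto (fun N : ℕ => 2 * N) atTop atTop :=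
    tendsto_id.const_mul_atTop' (by norm_num)
  have h2 : Tendsto (fun N : ℕ => (N + n).toNat) atTop atTop := by
    refine tendsto_atTop.mpr fun b => ?_
    filter_upwards [eventually_ge_atTop (b + n.natAbs)] with N hN
    omega
  have h3 : Tendsto (fun N : ℕ => 2 * N - (N + n).toNat) atTop atTop := by
    refine tendsto_atTop.mpr fun b => ?_
    filter_upwards [eventually_ge_atTop (b + n.natAbs)] with N hN
    omega
  have h4 := (h.comp h1).div ((h.comp h2).mul (h.comp h3)) (mul_ne_zero hE hE)
  have e : qFactInf Q / (qFactInf Q * qFactInf Q) = (qFactInf Q)⁻¹ := by field_simp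
  rw [e] at h4
  refine h4.congr' ?_
  filter_upwards [eventually_ge_atTop n.natAbs] with N hN
  rw [centralGauss, if_pos (by omega), gaussBinom, if_pos (by omega)]
  simp

lemma sum_gaussBinom_eq_tsum (Q : ℂ) (N : ℕ) (f : ℤ → ℂ) :
    ∑ k ∈ Finset.range (2 * N + 1), gaussBinom Q (2 * N) k * f (k - N) =
      ∑' n : ℤ, centralGauss Q N n * f n := by
  rw [tsum_eq_sum (s := Finset.Icc (-(N : ℤ)) N)]
  · refine Finset.sum_nbij' (fun k => (k : ℤ) - N) (fun n => (N + n).toNat) ?_ ?_ ?_ ?_ ?_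
    · intro k hk; simp only [Finset.mem_range, Finset.mem_Icc] at *; omega
    · intro k hk; simp only [Finset.mem_range, Finset.mem_Icc] at *; omega
    · intro k hk; simp
    · intro k hk; simp only [Finset.mem_Icc] at *; omega
    · intro k hk
      rw [centralGauss, if_pos (by omega)]
      congr 2
      simp
  · intro n hn
    rw [Finset.mem_Icc, not_and_or, not_le, not_le] at hn
    rw [centralGauss]
    split_ifs with h
    · rw [gaussBinom_of_lt Q (by omega), zero_mul]
    · rw [zero_mul]

/-- For y = xQ^{-N} the q-binomial theorem gives a product of 2N factors and the partial fractions
give the inverse of a product of 2N + 1 factors. Only the last factor 1 - xQ^N survives in their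
product. -/
lemma thetaSeries_mul_recip_finite {Q : ℂ} (hQ : ‖Q‖ < 1) (hQ0 : Q ≠ 0) {x : ℂ} (hx0 : x ≠ 0)
    (hx : ∀ j : ℤ, 1 - x * Q ^ j ≠ 0) (N : ℕ) :
    (∑' n : ℤ, centralGauss Q N n * ((-1) ^ n * Q ^ tri n * x ^ n)) *
      (∑' n : ℤ, centralGauss Q N n * recipTerm Q x 0 n) * (1 - x * Q ^ N) = qFact Q (2 * N) := by
  set y := x * Q ^ (-(N : ℤ)) with hy
  have hy0 : y ≠ 0 := mul_ne_zero hx0 (zpow_ne_zero _ hQ0)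
  have hyk : ∀ k : ℕ, y * Q ^ k = x * Q ^ ((k : ℤ) - N) := fun k => by
    rw [hy, mul_assoc, ← zpow_natCast Q k, ← zpow_add₀ hQ0]
    congr 2
    ring
  have hyn : ∀ i : ℕ, 1 - y * Q ^ i ≠ 0 := fun i => by rw [hyk]; exact hx _
  have m1 : (-1 : ℂ) ≠ 0 := by norm_num
  have htri : tri ((N : ℤ) + 1) = tri N + N := by rw [tri_add, tri_one]; ring
  have h2 := two_mul_tri N
  have h1 : ∏ i ∈ Finset.range (2 * N), (1 - y * Q ^ i) =
      (-1) ^ (N : ℤ) * x ^ (N : ℤ) * Q ^ (-tri (N + 1)) *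
        ∑' n : ℤ, centralGauss Q N n * ((-1) ^ n * Q ^ tri n * x ^ n) := by
    rw [prod_one_sub_eq_sum_gaussBinom hQ hQ0, ← sum_gaussBinom_eq_tsum, Finset.mul_sum]
    refine Finset.sum_congr rfl fun k _ => ?_
    obtain ⟨n, hn⟩ : ∃ n : ℤ, (k : ℤ) = N + n := ⟨k - N, by ring⟩
    have e0 : (k : ℤ) - N = n := by omega
    have e1 : (-1 : ℂ) ^ k = (-1) ^ (N : ℤ) * (-1) ^ n := by
      rw [← zpow_natCast, hn, zpow_add₀ m1]
    have e2 : Q ^ tri k * y ^ k = x ^ (N : ℤ) * x ^ n * (Q ^ (-tri (N + 1)) * Q ^ tri n) := by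
      rw [← zpow_natCast y, hy, mul_zpow, ← zpow_mul, mul_left_comm, ← zpow_add₀ hQ0,
        ← zpow_add₀ hQ0, ← zpow_add₀ hx0, hn, htri, tri_add]
      congr 2
      linear_combination h2
    rw [e0, e1, mul_assoc, e2]
    ring
  -- The exponent -N centres the sum: the resulting prefactor is inverse to the one in `h1`.
  have h3 := sum_gaussBinom_mul_pow_div_one_sub hQ hQ0 hy0 hyn (show N ≤ 2 * N by omega)
  have h4 : ∑ k ∈ Finset.range (2 * N + 1), (-1) ^ k * gaussBinom Q (2 * N) k * Q ^ tri (k + 1) *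
        (y * Q ^ k) ^ (-(N : ℤ)) / (1 - y * Q ^ k) =
      (-1) ^ (N : ℤ) * x ^ (-N : ℤ) * Q ^ (tri (N + 1)) *
        ∑' n : ℤ, centralGauss Q N n * recipTerm Q x 0 n := by
    rw [← sum_gaussBinom_eq_tsum, Finset.mul_sum]
    refine Finset.sum_congr rfl fun k _ => ?_
    obtain ⟨n, hn⟩ : ∃ n : ℤ, (k : ℤ) = N + n := ⟨k - N, by ring⟩
    have e0 : (k : ℤ) - N = n := by omega
    have e1 : (-1 : ℂ) ^ k = (-1) ^ (N : ℤ) * (-1) ^ n := by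
      rw [← zpow_natCast, hn, zpow_add₀ m1]
    have e2 : Q ^ tri (k + 1) * (x * Q ^ n) ^ (-(N : ℤ)) =
        x ^ (-N : ℤ) * (Q ^ (tri (N + 1)) * Q ^ tri (n + 1)) := by
      rw [mul_zpow, ← zpow_mul, mul_left_comm, ← zpow_add₀ hQ0,
        ← zpow_add₀ hQ0, hn, add_assoc, tri_add, htri]
      congr 2
      ring
    rw [hyk, e0, e1, recipTerm, zpow_zero, mul_one]
    linear_combination (-1) ^ (N : ℤ) * (-1) ^ n * gaussBinom Q (2 * N) k / (1 - x * Q ^ n) * e2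
  rw [h4, Finset.prod_range_succ, h1, hyk] at h3
  have e3 : ((2 * N : ℕ) : ℤ) - N = N := by push_cast; ring
  have hs : (-1 : ℂ) ^ (N : ℤ) * (-1) ^ (N : ℤ) = 1 := by
    rw [← mul_zpow]; simp
  have hxx : x ^ (N : ℤ) * x ^ (-N : ℤ) = 1 := by rw [← zpow_add₀ hx0]; simp
  have hqq : Q ^ (-tri (N + 1)) * Q ^ tri (N + 1) = 1 := by rw [← zpow_add₀ hQ0]; simp
  rw [e3, zpow_natCast Q N, eq_div_iff] at h3
  · rw [← h3]
    generalize (∑' n : ℤ, centralGauss Q N n * ((-1) ^ n * Q ^ tri n * x ^ n)) = A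
    generalize (∑' n : ℤ, centralGauss Q N n * recipTerm Q x 0 n) = B
    calc _ = ((-1 : ℂ) ^ (N : ℤ) * (-1) ^ (N : ℤ)) * (x ^ (N : ℤ) * x ^ (-N : ℤ)) *
          (Q ^ (-tri (N + 1)) * Q ^ tri (N + 1)) * (A * B * (1 - x * Q ^ N)) := by
            rw [hs, hxx, hqq]; ring
      _ = _ := by ring
  · have e4 : 1 - x * Q ^ N = 1 - y * Q ^ (2 * N) := by rw [hyk, e3, zpow_natCast]
    rw [e4, ← h1, ← Finset.prod_range_succ]
    exact Finset.prod_ne_zero_iff.mpr fun i _ => hyn i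

lemma summable_thetaSeries {Q : ℂ} (hQ : ‖Q‖ < 1) (hQ0 : Q ≠ 0) {x : ℂ} (hx0 : x ≠ 0) :
    Summable fun n : ℤ => (-1) ^ n * Q ^ tri n * x ^ n := by
  refine (summable_zpow_tri_mul hQ hQ0 (neg_ne_zero.mpr hx0)).congr fun n => ?_
  rw [neg_eq_neg_one_mul x, mul_zpow]
  ring

lemma summable_recipTerm {Q : ℂ} (hQ : ‖Q‖ < 1) (hQ0 : Q ≠ 0) {x : ℂ} (hx0 : x ≠ 0) (a : ℤ) :
    Summable (recipTerm Q x a) := by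
  obtain ⟨C, hC⟩ := exists_bound_inv_one_sub_zpow hQ hQ0 hx0
  have h := (summable_zpow_tri_mul hQ hQ0 (y := Q ^ (1 + a)) (zpow_ne_zero _ hQ0)).norm.mul_left
    (‖x ^ a‖ * C)
  refine Summable.of_norm_bounded h fun j => ?_
  have e : recipTerm Q x a j =
      (-1) ^ j * (Q ^ tri j * (Q ^ (1 + a)) ^ j) * x ^ a * (1 - x * Q ^ j)⁻¹ := by
    have : Q ^ tri (j + 1) * (Q ^ j) ^ a = Q ^ tri j * (Q ^ (1 + a)) ^ j := by
      rw [← zpow_mul, ← zpow_mul, ← zpow_add₀ hQ0, ← zpow_add₀ hQ0, tri_add, tri_one]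
      congr 1
      ring
    rw [← this, recipTerm, mul_zpow, div_eq_mul_inv]
    ring
  rw [e, norm_mul, norm_mul, norm_mul ((-1) ^ j), norm_neg_one_zpow, one_mul]
  calc _ ≤ ‖Q ^ tri j * (Q ^ (1 + a)) ^ j‖ * ‖x ^ a‖ * C := by gcongr; exact hC j
    _ = _ := by ring

/-- The reflection j ↦ -1 - 2a - j preserves the exponent of Q and reverses the sign. -/
lemma tsum_recipTerm_eq_zero {Q : ℂ} (hQ0 : Q ≠ 0) (a : ℤ) :
    ∑' j : ℤ, (-1) ^ j * Q ^ tri (j + 1) * (Q ^ j) ^ a = (0 : ℂ) := by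
  set f : ℤ → ℂ := fun j => (-1) ^ j * Q ^ tri (j + 1) * (Q ^ j) ^ a with hf
  have h : ∀ j, f (Equiv.subLeft (-1 - 2 * a) j) = -f j := by
    intro j
    have e1 : (-1 : ℂ) ^ (-1 - 2 * a - j) = -(-1) ^ j := by
      have : (-1 : ℂ) ^ (-1 - 2 * a - j) * (-1) ^ j = -1 := by
        rw [← zpow_add₀ (by norm_num), show -1 - 2 * a - j + j = 2 * (-1 - a) + 1 by ring,
          zpow_add₀ (by norm_num), zpow_mul]
        norm_num
      have h2 : (-1 : ℂ) ^ j * (-1) ^ j = 1 := by rw [← mul_zpow]; simp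
      linear_combination (-1) ^ j * this - (-1) ^ (-1 - 2 * a - j) * h2
    have e2 : Q ^ tri (-1 - 2 * a - j + 1) * (Q ^ (-1 - 2 * a - j)) ^ a =
        Q ^ tri (j + 1) * (Q ^ j) ^ a := by
      rw [← zpow_mul, ← zpow_mul, ← zpow_add₀ hQ0, ← zpow_add₀ hQ0]
      congr 1
      have h1 := two_mul_tri (-1 - 2 * a - j + 1)
      have h2 := two_mul_tri (j + 1)
      have : 2 * (tri (-1 - 2 * a - j + 1) + (-1 - 2 * a - j) * a) =
        2 * (tri (j + 1) + j * a) := by linear_combination h1 - h2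
      omega
    simp only [hf, Equiv.subLeft_apply]
    rw [e1, mul_assoc, e2]
    ring
  have h2 := (Equiv.subLeft (-1 - 2 * a)).tsum_eq f
  simp only [h, tsum_neg] at h2
  linear_combination -(1 / 2) * h2

/-- With X = xQ^j, X^a - X^{a+1} = X^a(1 - X) removes the poles, and the remaining series is zero by
the reflection above. -/
lemma tsum_recipTerm_succ {Q : ℂ} (hQ : ‖Q‖ < 1) (hQ0 : Q ≠ 0) {x : ℂ} (hx0 : x ≠ 0)
    (hx : ∀ j : ℤ, 1 - x * Q ^ j ≠ 0) (a : ℤ) :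
    ∑' j, recipTerm Q x (a + 1) j = ∑' j, recipTerm Q x a j := by
  rw [eq_comm, ← sub_eq_zero, ← (summable_recipTerm hQ hQ0 hx0 a).tsum_sub
    (summable_recipTerm hQ hQ0 hx0 (a + 1))]
  have h := congrArg (fun t => x ^ a * t) (tsum_recipTerm_eq_zero hQ0 a)
  simp only [mul_zero, ← tsum_mul_left] at h
  rw [← h]
  refine tsum_congr fun j => ?_
  have hX : x * Q ^ j ≠ 0 := mul_ne_zero hx0 (zpow_ne_zero _ hQ0)
  rw [recipTerm, recipTerm, zpow_add_one₀ hX, ← sub_div, div_eq_iff (hx j), mul_zpow]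
  ring

lemma tsum_recipTerm_eq {Q : ℂ} (hQ : ‖Q‖ < 1) (hQ0 : Q ≠ 0) {x : ℂ} (hx0 : x ≠ 0)
    (hx : ∀ j : ℤ, 1 - x * Q ^ j ≠ 0) (a : ℤ) :
    ∑' j, recipTerm Q x a j = ∑' j, recipTerm Q x 0 j := by
  induction a with
  | zero => rfl
  | succ a ih => rw [tsum_recipTerm_succ hQ hQ0 hx0 hx, ih]
  | pred a ih => rw [← tsum_recipTerm_succ hQ hQ0 hx0 hx, ← ih]; congr; ext; congr; ring

/-- The partial fraction expansion of the reciprocal of the theta series. -/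
theorem thetaSeries_mul_tsum_recipTerm {Q : ℂ} (hQ : ‖Q‖ < 1) (hQ0 : Q ≠ 0) {x : ℂ} (hx0 : x ≠ 0)
    (hx : ∀ j : ℤ, 1 - x * Q ^ j ≠ 0) (a : ℤ) :
    thetaSeries Q x * ∑' j, recipTerm Q x a j = qFactInf Q ^ 3 := by
  rw [tsum_recipTerm_eq hQ hQ0 hx0 hx a]
  obtain ⟨C, hC0, hC⟩ := exists_bound_centralGauss hQ
  -- Tannery's theorem. Each of the two sums acquires a factor (Q; Q)_∞⁻¹ while the right side tends
  -- to (Q; Q)_∞, whence the cube.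
  have key : ∀ f : ℤ → ℂ, Summable f → Tendsto (fun N => ∑' n : ℤ, centralGauss Q N n * f n) atTop
      (𝓝 ((qFactInf Q)⁻¹ * ∑' n, f n)) := by
    intro f hf
    rw [← tsum_mul_left]
    refine tendsto_tsum_of_dominated_convergence (hf.norm.mul_left C)
      (fun n => (tendsto_centralGauss hQ n).mul_const _) (Eventually.of_forall fun N n => ?_)
    rw [norm_mul]
    gcongr
    exact hC N n
  have h1 := key _ (summable_thetaSeries hQ hQ0 hx0)
  have h2 := key _ (summable_recipTerm hQ hQ0 hx0 0)
  have h3 : Tendsto (fun N : ℕ => 1 - x * Q ^ N) atTop (𝓝 (1 - x * 0)) :=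
    tendsto_const_nhds.sub ((tendsto_pow_atTop_nhds_zero_of_norm_lt_one hQ).const_mul x)
  have h4 := (h1.mul h2).mul h3
  simp only [thetaSeries_mul_recip_finite hQ hQ0 hx0 hx] at h4
  have h5 := tendsto_nhds_unique h4
    ((tendsto_qFact hQ).comp (tendsto_id.const_mul_atTop' (by norm_num : 0 < 2)))
  have hE := qFactInf_ne_zero hQ
  rw [thetaSeries]
  field_simp at h5
  linear_combination h5

lemma thetaSeries_ne_zero {Q : ℂ} (hQ : ‖Q‖ < 1) (hQ0 : Q ≠ 0) {x : ℂ} (hx0 : x ≠ 0)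
    (hx : ∀ j : ℤ, 1 - x * Q ^ j ≠ 0) : thetaSeries Q x ≠ 0 := by
  intro h
  have h1 := thetaSeries_mul_tsum_recipTerm hQ hQ0 hx0 hx 0
  rw [h, zero_mul] at h1
  exact pow_ne_zero 3 (qFactInf_ne_zero hQ) h1.symm

/-! ### Monomials in `q` and `w = exp (2 π i z)` -/

/-- The monomial `q^a w^b`, where `q = exp (2 π i τ)` and `w = exp (2 π i z)`. -/
def monom (τ z a b : ℂ) : ℂ := exp (2 * Real.pi * I * (τ * a + z * b))

lemma monom_ne_zero (τ z a b : ℂ) : monom τ z a b ≠ 0 := exp_ne_zero _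

lemma monom_mul (τ z a b a' b' : ℂ) :
    monom τ z a b * monom τ z a' b' = monom τ z (a + a') (b + b') := by
  rw [monom, monom, monom, ← exp_add]
  congr 1
  ring

lemma monom_zpow (τ z a b : ℂ) (n : ℤ) : monom τ z a b ^ n = monom τ z (n * a) (n * b) := by
  rw [monom, monom, ← exp_int_mul]
  congr 1
  ring

lemma monom_pow (τ z a b : ℂ) (n : ℕ) : monom τ z a b ^ n = monom τ z (n * a) (n * b) := by
  have := monom_zpow τ z a b n
  simpa using this

lemma monom_congr {τ z a b a' b' : ℂ} (ha : a = a') (hb : b = b') :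
    monom τ z a b = monom τ z a' b' := by rw [ha, hb]

lemma qPow_eq_monom (τ z x : ℂ) : qPow τ x = monom τ z x 0 := by
  simp [qPow, monom, mul_assoc]

lemma summable_monom_quadratic {τ : ℂ} (hτ : 0 < τ.im) (z : ℂ) {r : ℝ} (hr : 0 < r)
    (a₁ a₀ b₁ b₀ : ℂ) :
    Summable fun n : ℤ => monom τ z (r * n ^ 2 + a₁ * n + a₀) (b₁ * n + b₀) := by
  have h : (2 * Real.pi * I * τ * r : ℂ).re < 0 := by
    have e : (2 * Real.pi * I * τ * r : ℂ) = ((2 * Real.pi * r : ℝ) : ℂ) * (I * τ) := by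
      push_cast; ring
    rw [e, re_ofReal_mul]
    have : (I * τ).re = -τ.im := by simp
    rw [this]
    have := Real.pi_pos
    have : 0 < 2 * Real.pi * r * τ.im := by positivity
    linarith
  refine (summable_exp_quadratic h (2 * Real.pi * I * (τ * a₁ + z * b₁))
    (2 * Real.pi * I * (τ * a₀ + z * b₀))).congr fun n => ?_
  rw [monom]
  congr 1
  ring

lemma signedTheta_eq_tsum_monom (ε : ℤˣ) (k m τ z : ℂ) :
    signedTheta ε k m τ z = ∑' j : ℤ, (((ε ^ j : ℤˣ) : ℤ) : ℂ) *
      monom τ z (m * (j + k / (2 * m)) ^ 2) (m * (j + k / (2 * m))) := by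
  rw [signedTheta]
  refine tsum_congr fun j => ?_
  rw [mul_assoc, qPow, monom, ← exp_add]
  congr 2
  ring

lemma theta_eq_tsum_monom (k m τ z : ℂ) :
    theta k m τ z = ∑' j : ℤ, monom τ z (m * (j + k / (2 * m)) ^ 2) (m * (j + k / (2 * m))) := by
  rw [theta, signedTheta_eq_tsum_monom]
  simp

lemma summable_theta {τ : ℂ} (hτ : 0 < τ.im) (z k : ℂ) {m : ℕ} (hm : 1 ≤ m) :
    Summable fun j : ℤ => monom τ z (m * (j + k / (2 * m)) ^ 2) (m * (j + k / (2 * m))) := by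
  have hr : (0 : ℝ) < m := by exact_mod_cast hm
  refine (summable_monom_quadratic hτ z hr (2 * m * (k / (2 * m))) (m * (k / (2 * m)) ^ 2) m
    (m * (k / (2 * m)))).congr fun n => ?_
  refine monom_congr ?_ ?_ <;> push_cast <;> ring

lemma signedTheta_add_period (ε : ℤˣ) (k τ z : ℂ) {m : ℂ} (hm : m ≠ 0) (a : ℤ) :
    signedTheta ε (k + 2 * m * a) m τ z = (((ε ^ a : ℤˣ) : ℤ) : ℂ) * signedTheta ε k m τ z := by
  rw [signedTheta_eq_tsum_monom, signedTheta_eq_tsum_monom, ← tsum_mul_left,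
    ← (Equiv.addRight (-a)).tsum_eq]
  refine tsum_congr fun j => ?_
  have e : (((j + -a : ℤ) : ℂ)) + (k + 2 * m * a) / (2 * m) = j + k / (2 * m) := by
    push_cast
    field_simp
    ring
  have e2 : (((ε ^ (j + -a) : ℤˣ) : ℤ) : ℂ) =
      (((ε ^ a : ℤˣ) : ℤ) : ℂ) * (((ε ^ j : ℤˣ) : ℤ) : ℂ) := by
    have : ε ^ (j + -a) = ε ^ a * ε ^ j := by
      rw [zpow_add, zpow_neg, ← inv_zpow, Int.units_inv_eq_self, mul_comm]
    rw [this]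
    push_cast
    ring
  rw [Equiv.coe_addRight, e, e2, mul_assoc]

lemma theta_add_period (k τ z : ℂ) {m : ℂ} (hm : m ≠ 0) (a : ℤ) :
    theta (k + 2 * m * a) m τ z = theta k m τ z := by
  rw [theta, signedTheta_add_period 1 k τ z hm a]
  simp [theta]

lemma signedTheta_neg (ε : ℤˣ) (k m τ z : ℂ) :
    signedTheta ε k m τ (-z) = signedTheta ε (-k) m τ z := by
  rw [signedTheta_eq_tsum_monom, signedTheta_eq_tsum_monom, ← (Equiv.neg ℤ).tsum_eq]
  refine tsum_congr fun j => ?_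
  have e : (ε ^ (-j) : ℤˣ) = ε ^ j := by rw [zpow_neg, ← inv_zpow, Int.units_inv_eq_self]
  rw [Equiv.neg_apply, e, monom, monom]
  congr 3
  push_cast
  ring

lemma theta_neg (k m τ z : ℂ) : theta k m τ (-z) = theta (-k) m τ z := signedTheta_neg 1 k m τ z

lemma thetaDiff_add_period (k τ z : ℂ) {m : ℂ} (hm : m ≠ 0) (a : ℤ) :
    thetaDiff (k + 2 * m * a) m τ z = thetaDiff k m τ z := by
  have h := theta_add_period (-k) τ z hm (-a)
  have e : -(k + 2 * m * a) = -k + 2 * m * ((-a : ℤ) : ℂ) := by push_cast; ring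
  rw [thetaDiff, thetaDiff, theta_add_period _ _ _ hm, e, h]

lemma thetaDiff_neg (k m τ z : ℂ) : thetaDiff (-k) m τ z = -thetaDiff k m τ z := by
  rw [thetaDiff, thetaDiff, neg_neg, neg_sub]

/-! ### The quotient `η(2τ)³ / θ_{-1/2,1}(τ, z)` -/

/-- The monomial `w q^{2j + 1/2}`. -/
def rho (τ z : ℂ) (j : ℤ) : ℂ := monom τ z (2 * (j + 1 / 4)) 1

lemma norm_qPow_two {τ : ℂ} (hτ : 0 < τ.im) : ‖qPow τ 2‖ < 1 := by
  rw [qPow, norm_exp]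
  rw [← Real.exp_zero, Real.exp_lt_exp]
  have e : (2 * Real.pi * I * τ * 2 : ℂ) = ((4 * Real.pi : ℝ) : ℂ) * (I * τ) := by
    push_cast; ring
  rw [e, re_ofReal_mul]
  have : (I * τ).re = -τ.im := by simp
  rw [this]
  have := Real.pi_pos
  have : 0 < 4 * Real.pi * τ.im := by positivity
  linarith

lemma one_sub_mul_zpow_eq (τ z : ℂ) (j : ℤ) :
    1 - -monom τ z (1 / 2) 1 * qPow τ 2 ^ j = 1 + rho τ z j := by
  rw [qPow_eq_monom τ z, monom_zpow, neg_mul, sub_neg_eq_add, monom_mul, rho]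
  congr 1
  exact monom_congr (by ring) (by ring)

/-- With base Q = q² and x = -w q^{1/2}, the sign of x^j cancels the alternating sign of the series,
and 1 - xQ^j becomes 1 + ρ_j. -/
lemma theta_neg_half_eq (τ z : ℂ) :
    theta (-1 / 2) 1 τ z =
      monom τ z (1 / 16) (-1 / 4) * thetaSeries (qPow τ 2) (-monom τ z (1 / 2) 1) := by
  rw [theta_eq_tsum_monom, thetaSeries, ← tsum_mul_left]
  refine tsum_congr fun j => ?_
  have h1 : (-1 : ℂ) ^ j * (-1) ^ j = 1 := by rw [← mul_zpow]; simp
  rw [qPow_eq_monom τ z, monom_zpow, neg_eq_neg_one_mul (monom τ z (1 / 2) 1), mul_zpow,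
    monom_zpow, tri_cast]
  calc _ = monom τ z (1 / 16) (-1 / 4) * (monom τ z (j * (j - 1) / 2 * 2) ((tri j) * 0) *
        monom τ z (j * (1 / 2)) (j * 1)) := by
        rw [monom_mul, monom_mul]
        exact monom_congr (by ring) (by ring)
    _ = _ := by
        simp only [tri_cast]
        linear_combination -(monom τ z (1 / 16) (-1 / 4) *
          (monom τ z (j * (j - 1) / 2 * 2) (j * (j - 1) / 2 * 0) *
            monom τ z (j * (1 / 2)) (j * 1))) * h1

lemma eta_two_mul_pow_three (τ z : ℂ) :
    ModularForm.eta (2 * τ) ^ 3 = monom τ z (1 / 4) 0 * qFactInf (qPow τ 2) ^ 3 := by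
  have h : ∀ n : ℕ, ModularForm.eta_q n (2 * τ) = qPow τ 2 ^ (n + 1) := by
    intro n
    rw [ModularForm.eta_q_eq_pow, qPow]
    congr 2
    ring
  rw [ModularForm.eta, qFactInf, mul_pow]
  simp only [h]
  congr 1
  rw [Function.Periodic.qParam, ← exp_nat_mul, monom]
  congr 1
  push_cast
  ring

/-- The general term of the expansion of `η(2τ)³ / θ_{-1/2,1}(τ, z)`. -/
def etaQuotTerm (τ z : ℂ) (a j : ℤ) : ℂ :=
  (-1) ^ (j + a) * monom τ z ((j + 1 / 4) ^ 2 + 2 * (j + 1 / 4) * (1 / 4 + a)) (1 / 4 + a) /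
    (1 + rho τ z j)

lemma etaQuotTerm_eq (τ z : ℂ) (a j : ℤ) :
    etaQuotTerm τ z a j =
      monom τ z (3 / 16) (1 / 4) * recipTerm (qPow τ 2) (-monom τ z (1 / 2) 1) a j := by
  have h : -monom τ z (1 / 2) 1 * qPow τ 2 ^ j = -1 * rho τ z j := by
    linear_combination -one_sub_mul_zpow_eq τ z j
  rw [etaQuotTerm, recipTerm, one_sub_mul_zpow_eq, h, mul_zpow, mul_div_assoc', rho, monom_zpow,
    qPow_eq_monom τ z, monom_zpow, tri_cast]
  congr 1
  rw [zpow_add₀ (by norm_num : (-1 : ℂ) ≠ 0)]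
  calc _ = (-1) ^ j * (-1) ^ a * (monom τ z (3 / 16) (1 / 4) *
        (monom τ z (((j + 1 : ℤ) : ℂ) * (((j + 1 : ℤ) : ℂ) - 1) / 2 * 2) 0 *
          monom τ z (a * (2 * (j + 1 / 4))) (a * 1))) := by
        rw [monom_mul, monom_mul]
        congr 1
        refine monom_congr ?_ ?_ <;> push_cast <;> ring
    _ = _ := by
        rw [mul_zero]
        ring

lemma one_sub_mul_zpow_ne_zero {τ z : ℂ} (h : ∀ j, 1 + rho τ z j ≠ 0) (j : ℤ) :
    1 - -monom τ z (1 / 2) 1 * qPow τ 2 ^ j ≠ 0 := by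
  rw [one_sub_mul_zpow_eq]
  exact h j

lemma theta_neg_half_ne_zero {τ z : ℂ} (hτ : 0 < τ.im) (h : ∀ j, 1 + rho τ z j ≠ 0) :
    theta (-1 / 2) 1 τ z ≠ 0 := by
  rw [theta_neg_half_eq]
  exact mul_ne_zero (monom_ne_zero _ _ _ _) (thetaSeries_ne_zero (norm_qPow_two hτ) (exp_ne_zero _)
    (neg_ne_zero.mpr (monom_ne_zero _ _ _ _)) (one_sub_mul_zpow_ne_zero h))

/-- The value does not depend on a, so each term of a second theta series may be multiplied by an
expansion with its own a. -/
theorem tsum_etaQuotTerm {τ z : ℂ} (hτ : 0 < τ.im) (h : ∀ j, 1 + rho τ z j ≠ 0) (a : ℤ) :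
    ∑' j, etaQuotTerm τ z a j = ModularForm.eta (2 * τ) ^ 3 / theta (-1 / 2) 1 τ z := by
  rw [eq_div_iff (theta_neg_half_ne_zero hτ h), eta_two_mul_pow_three τ z,
    ← thetaSeries_mul_tsum_recipTerm (norm_qPow_two hτ) (exp_ne_zero _)
    (neg_ne_zero.mpr (monom_ne_zero _ _ _ _)) (one_sub_mul_zpow_ne_zero h) a, theta_neg_half_eq]
  simp only [etaQuotTerm_eq, tsum_mul_left]
  have e : monom τ z (1 / 4) 0 = monom τ z (3 / 16) (1 / 4) * monom τ z (1 / 16) (-1 / 4) := by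
    rw [monom_mul]
    exact monom_congr (by norm_num) (by norm_num)
  rw [e, qPow]
  ring

lemma exists_bound_inv_one_add_rho {τ : ℂ} (hτ : 0 < τ.im) (z : ℂ) :
    ∃ C : ℝ, ∀ j, ‖(1 + rho τ z j)⁻¹‖ ≤ C := by
  obtain ⟨C, hC⟩ := exists_bound_inv_one_sub_zpow (norm_qPow_two hτ) (exp_ne_zero _)
    (neg_ne_zero.mpr (monom_ne_zero τ z (1 / 2) 1))
  exact ⟨C, fun j => by rw [← one_sub_mul_zpow_eq]; exact hC j⟩

lemma one_add_rho_ne_zero {τ z : ℂ} (hz : ∀ a b : ℤ, z + τ / 2 - 1 / 2 ≠ a + b * (2 * τ)) (j : ℤ) :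
    1 + rho τ z j ≠ 0 := by
  intro h
  have h1 : rho τ z j = exp (Real.pi * I) := by
    rw [exp_pi_mul_I]; linear_combination h
  rw [rho, monom, exp_eq_exp_iff_exists_int] at h1
  obtain ⟨n, hn⟩ := h1
  apply hz n (-j)
  have h2 : (2 * Real.pi * I : ℂ) ≠ 0 := two_pi_I_ne_zero
  apply mul_left_cancel₀ h2
  push_cast
  linear_combination hn

/-! ### The Appell-Lerch expansion of a quotient of theta functions -/

/-- The general term of the double series of `η(2τ)³ θ_{M/2-2mc,M} / θ_{-1/2,1}`, `M = m + 1`;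
it is indexed by the index `j` of the pole and by the difference `J` of the two summation
indices. -/
def quotTerm (m : ℕ) (c τ z : ℂ) (J j : ℤ) : ℂ :=
  (-1) ^ J * monom τ z
    (-m * (j + 1 / 4) ^ 2 + (m + 1) * (J - m * c / (m + 1)) ^ 2 +
      2 * (j + 1 / 4) * (m * (j + 1 / 4 - c) + 1 / 2 + m * J))
    (m * (j + 1 / 4 - c) + 1 / 2 + m * J) / (1 + rho τ z j)

/-- The Appell-Lerch series `∑_j q^{-mλ²} ρ_j^{mλ-b} / (1 + ρ_j)`, `λ = j + 1/4`,
`ρ_j = w q^{2λ}`. -/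
def lerchTerm (m : ℕ) (b τ z : ℂ) (j : ℤ) : ℂ :=
  monom τ z (-m * (j + 1 / 4) ^ 2 + 2 * (j + 1 / 4) * (m * (j + 1 / 4) - b)) (m * (j + 1 / 4) - b) /
    (1 + rho τ z j)

/-- The sum of `lerchTerm`. -/
def lerchSum (m : ℕ) (b τ z : ℂ) : ℂ := ∑' j, lerchTerm m b τ z j

/-- The coefficient of the Appell-Lerch series. -/
def lerchCoeff (m : ℕ) (c τ : ℂ) (J : ℤ) : ℂ :=
  (-1) ^ ((m + 1 : ℤ) * J) * monom τ 0 ((m + 1) * (J - m * c / (m + 1)) ^ 2) 0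

/-- The general term of the indefinite double series. -/
def indefTerm (m : ℕ) (c τ z : ℂ) (J : ℕ) : ℂ :=
  ∑ k ∈ Finset.range (m * J), (-1) ^ J * (-1) ^ k *
    (qPow τ (-m * c ^ 2 / (m + 1) + J ^ 2 - (2 * k + 1) ^ 2 / (4 * m) + (J - c) * (2 * k + 1)) *
        theta (m / 2 - 2 * m * c - (2 * k + 1)) m τ z +
      qPow τ (-m * c ^ 2 / (m + 1) + J ^ 2 - (2 * k + 1) ^ 2 / (4 * m) + (J + c) * (2 * k + 1)) *
        theta (m / 2 - 2 * m * c + (2 * k + 1)) m τ z)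

variable {m : ℕ} {τ z : ℂ}

lemma summable_lerchTerm (hm : 1 ≤ m) (hτ : 0 < τ.im) (b z : ℂ) :
    Summable (lerchTerm m b τ z) := by
  obtain ⟨C, hC⟩ := exists_bound_inv_one_add_rho hτ z
  have hr : (0 : ℝ) < m := by exact_mod_cast hm
  have h := (summable_monom_quadratic hτ z hr (m / 2 - 2 * b)
    (-m / 16 + 1 / 2 * (m / 4 - b)) m (m / 4 - b)).norm.mul_right C
  refine Summable.of_norm_bounded h fun j => ?_
  rw [lerchTerm, div_eq_mul_inv, norm_mul]
  refine mul_le_mul (le_of_eq ?_) (hC j) (norm_nonneg _) (norm_nonneg _)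
  congr 1
  refine monom_congr ?_ ?_ <;> push_cast <;> ring

/-- Summability of the double series, in the coordinates that separate its exponent. -/
lemma summable_quotTerm_aux (hm : 1 ≤ m) (hτ : 0 < τ.im) (c z : ℂ) :
    Summable fun p : ℤ × ℤ => quotTerm m c τ z p.2 (p.1 - p.2) := by
  obtain ⟨C, hC⟩ := exists_bound_inv_one_add_rho hτ z
  have hr : (0 : ℝ) < m := by exact_mod_cast hm
  have hM : (m + 1 : ℂ) ≠ 0 := by exact_mod_cast Nat.succ_ne_zero m
  -- In the coordinates l = J + j and J the exponent of q is diagonal, m l² + J² plus lower terms,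
  -- and z couples to l only; the bound is a product of two convergent series.
  have h1 := (summable_monom_quadratic hτ z hr
    (2 * (m + 1) * (1 / 4 - m * c / (m + 1)) + 1 / 2)
    ((m + 1) * (1 / 4 - m * c / (m + 1)) ^ 2 - 1 / 16) m (m * (1 / 4 - c) + 1 / 2)).norm
  have h2 := (summable_monom_quadratic hτ z one_pos (-1) (1 / 4) 0 0).norm
  refine Summable.of_norm_bounded ((h1.mul_of_nonneg h2 (fun _ => norm_nonneg _)
    (fun _ => norm_nonneg _)).mul_right C) fun p => ?_
  obtain ⟨l, J⟩ := p
  rw [quotTerm, mul_div_assoc, norm_mul, norm_neg_one_zpow, one_mul, div_eq_mul_inv, norm_mul]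
  refine mul_le_mul (le_of_eq ?_) (hC _) (norm_nonneg _) (by positivity)
  rw [← norm_mul, monom_mul]
  congr 1
  refine monom_congr ?_ ?_
  · push_cast
    field_simp
    ring
  · push_cast
    ring

/-- The shear `(J, j) ↦ (J + j, J)`. -/
def shear : ℤ × ℤ ≃ ℤ × ℤ where
  toFun p := (p.1 + p.2, p.1)
  invFun p := (p.2, p.1 - p.2)
  left_inv p := by ext <;> simp
  right_inv p := by ext <;> simp

lemma summable_quotTerm (hm : 1 ≤ m) (hτ : 0 < τ.im) (c z : ℂ) :
    Summable fun p : ℤ × ℤ => quotTerm m c τ z p.1 p.2 := by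
  have h := shear.summable_iff.mpr (summable_quotTerm_aux hm hτ c z)
  refine h.congr fun p => ?_
  simp [shear]

/-- The theta function in the numerator is expanded in l, and the l-th term meets the eta quotient
expanded with a = -l. This lowers the w-exponent from (m + 1)l to ml; then J = l - j. -/
lemma tsum_quotTerm (hm : 1 ≤ m) (hτ : 0 < τ.im) (c : ℂ) (h : ∀ j, 1 + rho τ z j ≠ 0) :
    ∑' (J : ℤ) (j : ℤ), quotTerm m c τ z J j =
      ModularForm.eta (2 * τ) ^ 3 / theta (-1 / 2) 1 τ z *
        theta ((m + 1) / 2 - 2 * m * c) (m + 1) τ z := by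
  have hM : (m + 1 : ℂ) ≠ 0 := by exact_mod_cast Nat.succ_ne_zero m
  have h1 := (summable_quotTerm hm hτ c z).tsum_prod
  have h2 := (summable_quotTerm_aux hm hτ c z).tsum_prod
  have h3 := shear.tsum_eq fun p : ℤ × ℤ => quotTerm m c τ z p.2 (p.1 - p.2)
  have h4 : ∀ p : ℤ × ℤ, quotTerm m c τ z (shear p).2 ((shear p).1 - (shear p).2) =
      quotTerm m c τ z p.1 p.2 := fun p => by simp [shear]
  simp only [h4] at h3
  rw [← h1, h3, h2, theta_eq_tsum_monom ((m + 1) / 2 - 2 * m * c), ← tsum_mul_left]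
  refine tsum_congr fun l => ?_
  rw [← tsum_etaQuotTerm hτ h (-l), ← tsum_mul_right, ← (Equiv.subLeft l).tsum_eq]
  refine tsum_congr fun J => ?_
  simp only [Equiv.subLeft_apply, sub_sub_cancel]
  rw [quotTerm, etaQuotTerm, div_mul_eq_mul_div, mul_assoc ((-1) ^ (J + -l)), monom_mul]
  congr 2
  · have : l - J = (J + -l) + 2 * (l - J) := by ring
    rw [this, zpow_add₀ (by norm_num), zpow_mul (-1 : ℂ) 2]
    norm_num
  · refine monom_congr ?_ ?_
    · push_cast
      field_simp
      ring
    · push_cast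
      field_simp
      ring

lemma lerchCoeff_mul_lerchTerm (c : ℂ) (J j : ℤ) :
    lerchCoeff m c τ J * lerchTerm m (m * c - 1 / 2) τ z j =
      (-1) ^ ((m + 1 : ℤ) * J) * monom τ z
        (-m * (j + 1 / 4) ^ 2 + (m + 1) * (J - m * c / (m + 1)) ^ 2 +
          2 * (j + 1 / 4) * (m * (j + 1 / 4 - c) + 1 / 2))
        (m * (j + 1 / 4 - c) + 1 / 2) / (1 + rho τ z j) := by
  have h : monom τ 0 ((m + 1) * (J - m * c / (m + 1)) ^ 2) 0 =
      monom τ z ((m + 1) * (J - m * c / (m + 1)) ^ 2) 0 := by simp [monom]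
  rw [lerchCoeff, lerchTerm, h, mul_div_assoc', mul_assoc, monom_mul]
  congr 2
  refine monom_congr ?_ ?_ <;> ring

/-- Polynomial division, on the poles with positive index difference. -/
lemma quotTerm_natCast (hm : 1 ≤ m) (c : ℂ) (h : ∀ j, 1 + rho τ z j ≠ 0) (J : ℕ) (j : ℤ) :
    quotTerm m c τ z J j = lerchCoeff m c τ J * lerchTerm m (m * c - 1 / 2) τ z j +
      ∑ k ∈ Finset.range (m * J), (-1) ^ J * (-1) ^ k *
        (qPow τ (-m * c ^ 2 / (m + 1) + J ^ 2 - (2 * k + 1) ^ 2 / (4 * m) +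
            (J - c) * (2 * k + 1)) *
          monom τ z (m * (((j + J : ℤ) : ℂ) + (m / 2 - 2 * m * c - (2 * k + 1)) / (2 * m)) ^ 2)
            (m * (((j + J : ℤ) : ℂ) + (m / 2 - 2 * m * c - (2 * k + 1)) / (2 * m)))) := by
  have hM : (m + 1 : ℂ) ≠ 0 := by exact_mod_cast Nat.succ_ne_zero m
  have hm0 : (m : ℂ) ≠ 0 := by exact_mod_cast (by omega : m ≠ 0)
  set U := monom τ z (-m * (j + 1 / 4) ^ 2 + (m + 1) * (J - m * c / (m + 1)) ^ 2 +
          2 * (j + 1 / 4) * (m * (j + 1 / 4 - c) + 1 / 2))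
        (m * (j + 1 / 4 - c) + 1 / 2) with hU
  have e1 : quotTerm m c τ z J j = (-1) ^ J * (U * rho τ z j ^ (m * J)) / (1 + rho τ z j) := by
    rw [quotTerm, hU, rho, monom_pow, monom_mul, zpow_natCast]
    congr 2
    refine monom_congr ?_ ?_ <;> push_cast <;> ring
  have e2 : lerchCoeff m c τ J * lerchTerm m (m * c - 1 / 2) τ z j =
      (-1) ^ J * (U * (-1) ^ (m * J)) / (1 + rho τ z j) := by
    rw [lerchCoeff_mul_lerchTerm]
    have : (-1 : ℂ) ^ ((m + 1 : ℤ) * (J : ℤ)) = (-1) ^ J * (-1) ^ (m * J) := by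
      rw [← pow_add, ← zpow_natCast]
      congr 1
      push_cast
      ring
    rw [this, hU]
    simp only [Int.cast_natCast]
    ring
  have e3 : ∀ k ∈ Finset.range (m * J), (-1) ^ J * (-1) ^ k *
        (qPow τ (-m * c ^ 2 / (m + 1) + J ^ 2 - (2 * k + 1) ^ 2 / (4 * m) +
            (J - c) * (2 * k + 1)) *
          monom τ z (m * (((j + J : ℤ) : ℂ) + (m / 2 - 2 * m * c - (2 * k + 1)) / (2 * m)) ^ 2)
            (m * (((j + J : ℤ) : ℂ) + (m / 2 - 2 * m * c - (2 * k + 1)) / (2 * m)))) =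
      (-1) ^ J * U * ((-1) ^ k * rho τ z j ^ (m * J - 1 - k)) := by
    intro k hk
    have hk' : k + 1 ≤ m * J := Finset.mem_range.mp hk
    have ec : ((m * J - 1 - k : ℕ) : ℂ) = m * J - 1 - k := by
      rw [Nat.sub_sub, Nat.cast_sub (by omega)]
      push_cast
      ring
    have : U * rho τ z j ^ (m * J - 1 - k) =
        qPow τ (-m * c ^ 2 / (m + 1) + J ^ 2 - (2 * k + 1) ^ 2 / (4 * m) +
            (J - c) * (2 * k + 1)) *
          monom τ z (m * (((j + J : ℤ) : ℂ) + (m / 2 - 2 * m * c - (2 * k + 1)) / (2 * m)) ^ 2)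
            (m * (((j + J : ℤ) : ℂ) + (m / 2 - 2 * m * c - (2 * k + 1)) / (2 * m))) := by
      rw [hU, rho, monom_pow, monom_mul, qPow_eq_monom τ z, monom_mul, ec]
      refine monom_congr ?_ ?_
      · push_cast
        field_simp
        ring
      · push_cast
        field_simp
        ring
    rw [← this]
    ring
  -- ρ^{mJ} is divided by 1 + ρ: the remainder (-1)^{mJ} is its value at the pole, and each power of
  -- ρ in the quotient will sum over j to a theta function.
  have hg := geom_sum₂_mul (-1 : ℂ) (rho τ z j) (m * J)
  rw [Finset.sum_congr rfl e3, ← Finset.mul_sum, e1, e2, div_eq_iff (h j), add_mul,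
    div_mul_cancel₀ _ (h j)]
  linear_combination (-1) ^ J * U * hg

/-- Polynomial division, on the poles with negative index difference. -/
lemma quotTerm_neg_natCast (hm : 1 ≤ m) (c : ℂ) (h : ∀ j, 1 + rho τ z j ≠ 0) (J : ℕ) (j : ℤ) :
    quotTerm m c τ z (-J) j = lerchCoeff m c τ (-J) * lerchTerm m (m * c - 1 / 2) τ z j +
      ∑ k ∈ Finset.range (m * J), (-1) ^ J * (-1) ^ k *
        (qPow τ (-m * c ^ 2 / (m + 1) + J ^ 2 - (2 * k + 1) ^ 2 / (4 * m) +
            (J + c) * (2 * k + 1)) *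
          monom τ z (m * (((j + -J : ℤ) : ℂ) + (m / 2 - 2 * m * c + (2 * k + 1)) / (2 * m)) ^ 2)
            (m * (((j + -J : ℤ) : ℂ) + (m / 2 - 2 * m * c + (2 * k + 1)) / (2 * m)))) := by
  have hM : (m + 1 : ℂ) ≠ 0 := by exact_mod_cast Nat.succ_ne_zero m
  have hm0 : (m : ℂ) ≠ 0 := by exact_mod_cast (by omega : m ≠ 0)
  have hneg : ∀ a : ℕ, (-1 : ℂ) ^ (-(a : ℤ)) = (-1) ^ a := fun a => by
    rw [zpow_neg, zpow_natCast, ← inv_pow]; norm_num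
  set V := monom τ z (-m * (j + 1 / 4) ^ 2 + (m + 1) * (-J - m * c / (m + 1)) ^ 2 +
          2 * (j + 1 / 4) * (m * (j + 1 / 4 - c) + 1 / 2 - m * J))
        (m * (j + 1 / 4 - c) + 1 / 2 - m * J) with hV
  have e1 : quotTerm m c τ z (-J) j = (-1) ^ J * V / (1 + rho τ z j) := by
    rw [quotTerm, hV, hneg]
    congr 2
    refine monom_congr ?_ ?_ <;> push_cast <;> ring
  have e2 : lerchCoeff m c τ (-J) * lerchTerm m (m * c - 1 / 2) τ z j =
      (-1) ^ J * (V * (-1 * rho τ z j) ^ (m * J)) / (1 + rho τ z j) := by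
    rw [lerchCoeff_mul_lerchTerm]
    have : (-1 : ℂ) ^ ((m + 1 : ℤ) * (-J : ℤ)) = (-1) ^ J * (-1) ^ (m * J) := by
      rw [← pow_add, ← hneg]
      congr 1
      push_cast
      ring
    rw [this, mul_pow, mul_left_comm V, ← mul_assoc, hV, rho, monom_pow, monom_mul]
    congr 2
    refine monom_congr ?_ ?_ <;> push_cast <;> ring
  have e3 : ∀ k ∈ Finset.range (m * J), (-1) ^ J * (-1) ^ k *
        (qPow τ (-m * c ^ 2 / (m + 1) + J ^ 2 - (2 * k + 1) ^ 2 / (4 * m) +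
            (J + c) * (2 * k + 1)) *
          monom τ z (m * (((j + -J : ℤ) : ℂ) + (m / 2 - 2 * m * c + (2 * k + 1)) / (2 * m)) ^ 2)
            (m * (((j + -J : ℤ) : ℂ) + (m / 2 - 2 * m * c + (2 * k + 1)) / (2 * m)))) =
      (-1) ^ J * V * (-1 * rho τ z j) ^ k := by
    intro k hk
    have : V * rho τ z j ^ k =
        qPow τ (-m * c ^ 2 / (m + 1) + J ^ 2 - (2 * k + 1) ^ 2 / (4 * m) +
            (J + c) * (2 * k + 1)) *
          monom τ z (m * (((j + -J : ℤ) : ℂ) + (m / 2 - 2 * m * c + (2 * k + 1)) / (2 * m)) ^ 2)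
            (m * (((j + -J : ℤ) : ℂ) + (m / 2 - 2 * m * c + (2 * k + 1)) / (2 * m))) := by
      rw [hV, rho, monom_pow, monom_mul, qPow_eq_monom τ z, monom_mul]
      refine monom_congr ?_ ?_
      · push_cast
        field_simp
        ring
      · push_cast
        field_simp
        ring
    rw [← this, mul_pow]
    ring
  -- Here the Lerch numerator carries the extra power ρ^{mJ}, so the division is that of 1 -
  -- (-ρ)^{mJ} by 1 + ρ.
  have hg := geom_sum_mul (-1 * rho τ z j) (m * J)
  rw [Finset.sum_congr rfl e3, ← Finset.mul_sum, e1, e2, div_eq_iff (h j), add_mul,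
    div_mul_cancel₀ _ (h j)]
  linear_combination (-1) ^ J * V * hg

lemma tsum_quotTerm_of_sum (hm : 1 ≤ m) (hτ : 0 < τ.im) (c : ℂ) {J : ℤ} {n : ℕ} {v κ : ℕ → ℂ}
    (h : ∀ j : ℤ, quotTerm m c τ z J j = lerchCoeff m c τ J * lerchTerm m (m * c - 1 / 2) τ z j +
      ∑ k ∈ Finset.range n, v k *
          monom τ z (m * (((j + J : ℤ) : ℂ) + κ k / (2 * m)) ^ 2)
            (m * (((j + J : ℤ) : ℂ) + κ k / (2 * m)))) :
    ∑' j, quotTerm m c τ z J j = lerchCoeff m c τ J * lerchSum m (m * c - 1 / 2) τ z +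
      ∑ k ∈ Finset.range n, v k * theta (κ k) m τ z := by
  have hs : ∀ k, Summable fun j : ℤ => v k *
      monom τ z (m * (((j + J : ℤ) : ℂ) + κ k / (2 * m)) ^ 2)
            (m * (((j + J : ℤ) : ℂ) + κ k / (2 * m))) := fun k =>
    ((Equiv.addRight J).summable_iff.mpr (summable_theta hτ z (κ k) hm)).mul_left _
  simp only [h]
  rw [Summable.tsum_add ((summable_lerchTerm hm hτ _ z).mul_left _)
    (summable_sum fun k _ => hs k), tsum_mul_left, lerchSum,
    Summable.tsum_finsetSum fun k _ => hs k]
  congr 1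
  refine Finset.sum_congr rfl fun k _ => ?_
  rw [tsum_mul_left, theta_eq_tsum_monom]
  congr 1
  exact (Equiv.addRight J).tsum_eq fun j : ℤ =>
    monom τ z (m * (j + κ k / (2 * m)) ^ 2) (m * (j + κ k / (2 * m)))

lemma tsum_quotTerm_add (hm : 1 ≤ m) (hτ : 0 < τ.im) (c : ℂ) (h : ∀ j, 1 + rho τ z j ≠ 0) (J : ℕ) :
    ∑' j, quotTerm m c τ z J j + ∑' j, quotTerm m c τ z (-J) j =
      (lerchCoeff m c τ J + lerchCoeff m c τ (-J)) * lerchSum m (m * c - 1 / 2) τ z +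
        indefTerm m c τ z J := by
  have h1 := tsum_quotTerm_of_sum (z := z) hm hτ c (J := J) (fun j => by
    rw [quotTerm_natCast hm c h]
    congr 1
    exact Finset.sum_congr rfl fun k _ => (mul_assoc _ _ _).symm)
  have h2 := tsum_quotTerm_of_sum (z := z) hm hτ c (J := -J) (fun j => by
    rw [quotTerm_neg_natCast hm c h]
    congr 1
    exact Finset.sum_congr rfl fun k _ => (mul_assoc _ _ _).symm)
  rw [h1, h2, indefTerm]
  simp only [mul_add, Finset.sum_add_distrib]
  simp only [mul_assoc]
  ring

lemma summable_lerchCoeff (hτ : 0 < τ.im) (c : ℂ) : Summable (lerchCoeff m c τ) := by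
  have hM : (m + 1 : ℂ) ≠ 0 := by exact_mod_cast Nat.succ_ne_zero m
  have h := (summable_monom_quadratic hτ 0 (r := m + 1) (by positivity) (-2 * m * c)
    (m ^ 2 * c ^ 2 / (m + 1)) 0 0).norm
  refine Summable.of_norm_bounded h fun J => ?_
  rw [lerchCoeff, norm_mul, norm_neg_one_zpow, one_mul]
  refine le_of_eq ?_
  congr 1
  refine monom_congr ?_ ?_
  · push_cast
    field_simp
    ring
  · ring

/-- The terms J and -J are treated together because the indefinite part is defined only for the
pair. At J = 0 the pair counts one term twice, hence the condition `H 0 = 0`. -/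
lemma tsum_int_eq_of_add_neg {S L : ℤ → ℂ} {H : ℕ → ℂ} {G : ℂ} (hs : Summable S) (hl : Summable L)
    (hadd : ∀ J : ℕ, S J + S (-J) = (L J + L (-J)) * G + H J) (h0 : H 0 = 0) :
    Summable (fun n : ℕ => H (n + 1)) ∧ ∑' J, S J = (∑' J, L J) * G + ∑' n : ℕ, H (n + 1) := by
  have inj1 : Function.Injective fun n : ℕ => (n : ℤ) + 1 := fun a b hab => by simpa using hab
  have inj2 : Function.Injective fun n : ℕ => -((n : ℤ) + 1) := fun a b hab => by simpa using hab
  have s1 : Summable fun n : ℕ => S ((n : ℤ) + 1) := hs.comp_injective inj1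
  have s2 : Summable fun n : ℕ => S (-((n : ℤ) + 1)) := hs.comp_injective inj2
  have l1 : Summable fun n : ℕ => L ((n : ℤ) + 1) := hl.comp_injective inj1
  have l2 : Summable fun n : ℕ => L (-((n : ℤ) + 1)) := hl.comp_injective inj2
  have key : ∀ n : ℕ, H (n + 1) = (S ((n : ℤ) + 1) + S (-((n : ℤ) + 1))) -
      (L ((n : ℤ) + 1) + L (-((n : ℤ) + 1))) * G := by
    intro n
    have := hadd (n + 1)
    push_cast at this ⊢
    rw [this]
    ring
  have key0 : S 0 = L 0 * G := by
    have := hadd 0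
    rw [h0, Nat.cast_zero, neg_zero] at this
    linear_combination this / 2
  have hsum : Summable (fun n : ℕ => H (n + 1)) := by
    simp only [key]
    exact (s1.add s2).sub ((l1.add l2).mul_right _)
  refine ⟨hsum, ?_⟩
  rw [tsum_of_add_one_of_neg_add_one s1 s2, tsum_of_add_one_of_neg_add_one l1 l2, key0]
  simp only [key]
  rw [Summable.tsum_sub (s1.add s2) ((l1.add l2).mul_right _), tsum_mul_right,
    Summable.tsum_add s1 s2, Summable.tsum_add l1 l2]
  ring

/-- The expansion of a quotient of theta functions into an Appell-Lerch series and an indefinite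
theta series. -/
theorem quot_eq_lerchSum_add (hm : 1 ≤ m) (hτ : 0 < τ.im) (c : ℂ) (h : ∀ j, 1 + rho τ z j ≠ 0) :
    Summable (fun n : ℕ => indefTerm m c τ z (n + 1)) ∧
    ModularForm.eta (2 * τ) ^ 3 / theta (-1 / 2) 1 τ z *
        theta ((m + 1) / 2 - 2 * m * c) (m + 1) τ z =
      (∑' J, lerchCoeff m c τ J) * lerchSum m (m * c - 1 / 2) τ z +
        ∑' n : ℕ, indefTerm m c τ z (n + 1) := by
  rw [← tsum_quotTerm hm hτ c h]
  exact tsum_int_eq_of_add_neg (summable_quotTerm hm hτ c z).prod (summable_lerchCoeff hτ c)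
    (tsum_quotTerm_add hm hτ c h) (by simp [indefTerm])

/-! ### Theta constants, and `Φ` in terms of the Appell-Lerch series -/

lemma norm_qPow_ofReal (τ : ℂ) (x : ℝ) : ‖qPow τ x‖ = Real.exp (-(2 * Real.pi * τ.im * x)) := by
  rw [qPow, norm_exp]
  congr 1
  have e : (2 * Real.pi * I * τ * x : ℂ) = ((2 * Real.pi * x : ℝ) : ℂ) * (I * τ) := by
    push_cast; ring
  rw [e, re_ofReal_mul]
  have : (I * τ).re = -τ.im := by simp
  rw [this]
  ring

lemma qPow_add (τ x y : ℂ) : qPow τ (x + y) = qPow τ x * qPow τ y := by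
  rw [qPow, qPow, qPow, ← exp_add, mul_add]

/-- For real x, |q^x| = 1 forces x = 0, and there the value is 2. -/
lemma one_add_qPow_ne_zero (hτ : 0 < τ.im) (x : ℝ) : 1 + qPow τ x ≠ 0 := by
  intro h
  have h1 : qPow τ x = -1 := by linear_combination h
  have h2 := norm_qPow_ofReal τ x
  rw [h1, norm_neg, norm_one, eq_comm, Real.exp_eq_one_iff] at h2
  have hx : x = 0 := by
    have := Real.pi_pos
    have h3 : 2 * Real.pi * τ.im ≠ 0 := by positivity
    have h4 : 2 * Real.pi * τ.im * x = 0 := by linarith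
    exact (mul_eq_zero.mp h4).resolve_left h3
  rw [hx, qPow, ofReal_zero, mul_zero, exp_zero] at h1
  norm_num at h1

/-- A theta constant with positive signs and real characteristic does not vanish. -/
theorem theta_constant_ne_zero (hτ : 0 < τ.im) (k : ℝ) {M : ℕ} (hM : 1 ≤ M) :
    theta k M τ 0 ≠ 0 := by
  have hM0 : (M : ℂ) ≠ 0 := by exact_mod_cast (by omega : M ≠ 0)
  set Q := qPow τ ((2 * M : ℝ) : ℂ) with hQ
  set x := -qPow τ ((M + k : ℝ) : ℂ) with hx
  have hQ1 : ‖Q‖ < 1 := by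
    rw [hQ, norm_qPow_ofReal, Real.exp_lt_one_iff]
    have := Real.pi_pos
    have hM' : (0 : ℝ) < M := by exact_mod_cast hM
    have : 0 < 2 * Real.pi * τ.im * (2 * M) := by positivity
    linarith
  -- The theta series can vanish only where some x Q^j = 1, while here x Q^j is minus a real power
  -- of q.
  have hp : ∀ j : ℤ, 1 - x * Q ^ j ≠ 0 := by
    intro j
    have e : 1 - x * Q ^ j = 1 + qPow τ ((M + k + 2 * M * j : ℝ) : ℂ) := by
      rw [hx, hQ, qPow_eq_monom τ 0, qPow_eq_monom τ 0, qPow_eq_monom τ 0, monom_zpow, neg_mul,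
        sub_neg_eq_add, monom_mul]
      congr 1
      refine monom_congr ?_ ?_ <;> push_cast <;> ring
    rw [e]
    exact one_add_qPow_ne_zero hτ _
  have h := thetaSeries_ne_zero hQ1 (exp_ne_zero _) (neg_ne_zero.mpr (exp_ne_zero _)) hp
  have e : theta k M τ 0 = monom τ 0 (k ^ 2 / (4 * M)) 0 * thetaSeries Q x := by
    rw [theta_eq_tsum_monom, thetaSeries, ← tsum_mul_left]
    refine tsum_congr fun j => ?_
    have h1 : (-1 : ℂ) ^ j * (-1) ^ j = 1 := by rw [← mul_zpow]; simp
    have h2 : monom τ 0 (M * (j + k / (2 * M)) ^ 2) (M * (j + k / (2 * M))) =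
        monom τ 0 (M * (j + k / (2 * M)) ^ 2) 0 := by simp [monom]
    have h3 : Q ^ tri j * qPow τ ((M + k : ℝ) : ℂ) ^ j =
        monom τ 0 (M * j ^ 2 + k * j) 0 := by
      rw [hQ, qPow_eq_monom τ 0, qPow_eq_monom τ 0, monom_zpow, monom_zpow, monom_mul, tri_cast]
      refine monom_congr ?_ ?_ <;> push_cast <;> ring
    rw [h2, hx, neg_eq_neg_one_mul (qPow τ _), mul_zpow]
    calc _ = monom τ 0 (k ^ 2 / (4 * M)) 0 * monom τ 0 (M * j ^ 2 + k * j) 0 := by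
          rw [monom_mul]
          refine monom_congr ?_ ?_
          · field_simp
            ring
          · ring
      _ = _ := by
          rw [← h3]
          linear_combination -(monom τ 0 (k ^ 2 / (4 * M)) 0 *
            (Q ^ tri j * qPow τ ((M + k : ℝ) : ℂ) ^ j)) * h1
  rw [e]
  exact mul_ne_zero (monom_ne_zero _ _ _ _) h

lemma paritySign_zpow (m : ℕ) (j : ℤ) :
    (((paritySign m ^ j : ℤˣ) : ℤ) : ℂ) = (-1) ^ ((m + 1 : ℤ) * j) := by
  rw [zpow_mul]
  unfold paritySign
  split_ifs with h
  · have : Even ((m : ℤ) + 1) := by exact_mod_cast h.add_one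
    rw [this.neg_one_zpow]
    simp
  · have : Odd ((m : ℤ) + 1) := by exact_mod_cast (Nat.not_odd_iff_even.mp h).add_one
    rw [this.neg_one_zpow]
    rcases Int.even_or_odd j with hj | hj <;> simp [hj.neg_one_zpow]

/-- The sign (-1)^J of the double series times the remainder (-1)^{mJ} is what makes the theta
constant alternate exactly for even m. -/
lemma tsum_lerchCoeff (m : ℕ) (c τ : ℂ) :
    ∑' J, lerchCoeff m c τ J = signedTheta (paritySign m) (2 * m * c) (m + 1) τ 0 := by
  have hM : (m + 1 : ℂ) ≠ 0 := by exact_mod_cast Nat.succ_ne_zero m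
  rw [signedTheta_eq_tsum_monom, ← (Equiv.neg ℤ).tsum_eq]
  refine tsum_congr fun J => ?_
  have e : (-1 : ℂ) ^ ((m + 1 : ℤ) * -J) = (-1) ^ ((m + 1 : ℤ) * J) := by
    rw [mul_neg, zpow_neg, ← inv_zpow]
    norm_num
  rw [Equiv.neg_apply, lerchCoeff, paritySign_zpow, e]
  congr 1
  rw [monom, monom]
  congr 2
  push_cast
  field_simp
  ring

/-- The difference `lerchSum(z) - lerchSum(-z)`. -/
def lerchDiff (m : ℕ) (b τ z : ℂ) : ℂ := lerchSum m b τ z - lerchSum m b τ (-z)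

/-- The numerators for b and b + 1 differ by the factor ρ_j, so their sum cancels 1 + ρ_j.
Completing the square leaves a theta series. -/
lemma lerchSum_add_one (hm : 1 ≤ m) (hτ : 0 < τ.im) (h : ∀ j, 1 + rho τ z j ≠ 0) (b : ℂ) :
    lerchSum m b τ z = -lerchSum m (b + 1) τ z +
      qPow τ (-(b + 1) ^ 2 / m) * theta (m / 2 - 2 * (b + 1)) m τ z := by
  have hm0 : (m : ℂ) ≠ 0 := by exact_mod_cast (by omega : m ≠ 0)
  rw [eq_neg_add_iff_add_eq, lerchSum, lerchSum, add_comm,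
    ← (summable_lerchTerm hm hτ b z).tsum_add (summable_lerchTerm hm hτ (b + 1) z),
    theta_eq_tsum_monom, ← tsum_mul_left]
  refine tsum_congr fun j => ?_
  have e : monom τ z (-m * (j + 1 / 4) ^ 2 + 2 * (j + 1 / 4) * (m * (j + 1 / 4) - b))
      (m * (j + 1 / 4) - b) =
      monom τ z (-m * (j + 1 / 4) ^ 2 + 2 * (j + 1 / 4) * (m * (j + 1 / 4) - (b + 1)))
        (m * (j + 1 / 4) - (b + 1)) * rho τ z j := by
    rw [rho, monom_mul]
    exact monom_congr (by ring) (by ring)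
  rw [lerchTerm, lerchTerm, e, ← add_div, div_eq_iff (h j), qPow_eq_monom τ z, monom_mul]
  have e2 : monom τ z (-m * (j + 1 / 4) ^ 2 + 2 * (j + 1 / 4) * (m * (j + 1 / 4) - (b + 1)))
        (m * (j + 1 / 4) - (b + 1)) =
      monom τ z (-(b + 1) ^ 2 / m + m * (j + (m / 2 - 2 * (b + 1)) / (2 * m)) ^ 2)
        (0 + m * (j + (m / 2 - 2 * (b + 1)) / (2 * m))) := by
    refine monom_congr ?_ ?_ <;> field_simp <;> ring
  rw [e2]
  ring

lemma lerchDiff_add_natCast (hm : 1 ≤ m) (hτ : 0 < τ.im) (h : ∀ j, 1 + rho τ z j ≠ 0)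
    (h' : ∀ j, 1 + rho τ (-z) j ≠ 0) (b : ℂ) (L : ℕ) :
    lerchDiff m b τ z = (-1) ^ L * lerchDiff m (b + L) τ z -
      ∑ k ∈ Finset.Icc 1 L, (-1) ^ k *
        qPow τ (-(b + k) ^ 2 / m) * thetaDiff (m / 2 - 2 * (b + k)) m τ z := by
  induction L with
  | zero => simp
  | succ L ih =>
    rw [ih, Finset.sum_Icc_succ_top (by omega), lerchDiff, lerchDiff, lerchSum_add_one hm hτ h,
      lerchSum_add_one hm hτ h', theta_neg, thetaDiff]
    push_cast
    rw [add_assoc b]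
    ring

lemma Phi₂_eq_Phi₁ (m s τ z₁ z₂ t : ℂ) : Phi₂ m s τ z₁ z₂ t = Phi₁ m s τ (-z₂) (-z₁) t := by
  rw [Phi₁, Phi₂]
  congr 1
  refine tsum_congr fun j => ?_
  congr 4 <;> ring_nf

/-- The half shifts turn the denominators into 1 + ρ_j, and t = τ/8 supplies the constant q^{-m/16}
left by completing the square in j + 1/4. -/
lemma Phi₁_eq_lerchSum (m : ℕ) (s τ z : ℂ) :
    Phi₁ (m / 2) s (2 * τ) (z + τ / 2 - 1 / 2) (z - τ / 2 + 1 / 2) (τ / 8) =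
      exp (-(Real.pi * I * s)) * lerchSum m (m / 4 - s) τ z := by
  rw [Phi₁, lerchSum, ← tsum_mul_left, ← tsum_mul_left]
  refine tsum_congr fun j => ?_
  have e : 1 - exp (2 * Real.pi * I * (z + τ / 2 - 1 / 2)) * qPow (2 * τ) j = 1 + rho τ z j := by
    have : exp (2 * Real.pi * I * (z + τ / 2 - 1 / 2)) * qPow (2 * τ) j =
        exp (-(Real.pi * I)) * rho τ z j := by
      rw [qPow, rho, monom, ← exp_add, ← exp_add]
      congr 1
      ring
    rw [this, exp_neg, exp_pi_mul_I]
    norm_num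
  have key : exp (-2 * Real.pi * I * (m / 2) * (τ / 8)) *
      (exp (2 * Real.pi * I * (m / 2) * j * (z + τ / 2 - 1 / 2 + (z - τ / 2 + 1 / 2)) +
        2 * Real.pi * I * s * (z + τ / 2 - 1 / 2)) * qPow (2 * τ) (m / 2 * j ^ 2 + s * j)) =
      exp (-(Real.pi * I * s)) *
        monom τ z (-m * (j + 1 / 4) ^ 2 + 2 * (j + 1 / 4) * (m * (j + 1 / 4) - (m / 4 - s)))
          (m * (j + 1 / 4) - (m / 4 - s)) := by
    rw [qPow, monom, ← exp_add, ← exp_add, ← exp_add]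
    congr 1
    ring
  rw [e, lerchTerm]
  linear_combination key / (1 + rho τ z j)

lemma Phi_eq_lerchDiff (m : ℕ) (s τ z : ℂ) :
    Phi (m / 2) s (2 * τ) (z + τ / 2 - 1 / 2) (z - τ / 2 + 1 / 2) (τ / 8) =
      exp (-(Real.pi * I * s)) * lerchDiff m (m / 4 - s) τ z := by
  have e1 : -(z - τ / 2 + 1 / 2) = -z + τ / 2 - 1 / 2 := by ring
  have e2 : -(z + τ / 2 - 1 / 2) = -z - τ / 2 + 1 / 2 := by ring
  rw [Phi, Phi₂_eq_Phi₁, e1, e2, Phi₁_eq_lerchSum, Phi₁_eq_lerchSum, lerchDiff, mul_sub]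

/-! ### The two indefinite series -/

lemma sum_Icc_one_eq_sum_range (f : ℕ → ℂ) (n : ℕ) :
    ∑ r ∈ Finset.Icc 1 n, f r = ∑ r ∈ Finset.range n, f (r + 1) := by
  induction n with
  | zero => simp
  | succ n ih => rw [Finset.sum_Icc_succ_top (by omega), ih, Finset.sum_range_succ]

/-- Odd numbers below 2m are paired by N ↔ 2m - N; the fixed point N = m, present when m is odd,
contributes nothing. -/
lemma sum_range_odd_eq_sum_oddBelow (m : ℕ) (G : ℕ → ℂ) (hG : Odd m → G m = 0) :
    ∑ k ∈ Finset.range m, G (2 * k + 1) = ∑ k ∈ oddBelow m, (G k + G (2 * m - k)) := by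
  have h1 : ∑ k ∈ Finset.range m, G (2 * k + 1) =
      ∑ N ∈ (Finset.range (2 * m)).filter Odd, G N := by
    refine Finset.sum_nbij' (fun k => 2 * k + 1) (fun N => N / 2) ?_ ?_ ?_ ?_ ?_
    · intro k hk
      simp only [Finset.mem_range, Finset.mem_filter] at *
      exact ⟨by omega, ⟨k, rfl⟩⟩
    · intro N hN
      simp only [Finset.mem_range, Finset.mem_filter] at *
      omega
    · intro k _
      omega
    · intro N hN
      simp only [Finset.mem_range, Finset.mem_filter, Nat.odd_iff] at *
      omega
    · intro k _
      rfl
  have h2 : ∑ k ∈ oddBelow m, G (2 * m - k) =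
      ∑ N ∈ ((Finset.range (2 * m)).filter Odd).filter (fun N => ¬ N ≤ m), G N := by
    refine Finset.sum_nbij' (fun k => 2 * m - k) (fun N => 2 * m - N) ?_ ?_ ?_ ?_ ?_ <;>
    · intro k hk
      simp only [oddBelow, Finset.mem_range, Finset.mem_filter, Finset.mem_Icc, Nat.odd_iff] at *
      try omega
  have h3 : ∑ k ∈ oddBelow m, G k =
      ∑ N ∈ ((Finset.range (2 * m)).filter Odd).filter (fun N => N ≤ m), G N := by
    refine Finset.sum_subset ?_ ?_
    · intro k hk
      simp only [oddBelow, Finset.mem_range, Finset.mem_filter, Finset.mem_Icc, Nat.odd_iff] at *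
      omega
    · intro k hk hk'
      have hkm : k = m := by
        simp only [oddBelow, Finset.mem_range, Finset.mem_filter, Finset.mem_Icc,
          Nat.odd_iff] at *
        omega
      have ho : Odd k := (Finset.mem_filter.mp (Finset.mem_filter.mp hk).1).2
      subst hkm
      exact hG ho
  rw [h1, Finset.sum_add_distrib, h2, h3, Finset.sum_filter_add_sum_filter_not]

lemma sum_range_mul_odd (m : ℕ) (G : ℕ → ℂ) (hG : ∀ r, Odd m → G (2 * m * r + m) = 0) (J : ℕ) :
    ∑ k ∈ Finset.range (m * J), G (2 * k + 1) =
      ∑ r ∈ Finset.range J, ∑ k ∈ oddBelow m, (G (2 * m * r + k) + G (2 * m * (r + 1) - k)) := by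
  induction J with
  | zero => simp
  | succ J ih =>
    rw [Finset.sum_range_succ, ← ih, mul_add_one, Finset.sum_range_add]
    congr 1
    have h := sum_range_odd_eq_sum_oddBelow m (fun N => G (2 * m * J + N)) (hG J)
    have e1 : ∀ k, 2 * (m * J + k) + 1 = 2 * m * J + (2 * k + 1) := fun k => by ring
    simp only [e1]
    rw [h]
    refine Finset.sum_congr rfl fun k hk => ?_
    have hk' : k ≤ 2 * m := by
      simp only [oddBelow, Finset.mem_filter, Finset.mem_Icc] at hk
      omega
    congr 2
    rw [mul_add_one, Nat.add_sub_assoc hk']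

/-- The common general term of the series `A` and `B`, as a function of an odd number `N`. -/
def oddTerm (m : ℕ) (c s τ z : ℂ) (J N : ℕ) : ℂ :=
  (-1) ^ J * qPow τ (J ^ 2 - N ^ 2 / (4 * m)) *
    (qPow τ ((J + c) * N) * exp (-(Real.pi * I / 2 * N)) +
      qPow τ ((J - c) * N) * exp (Real.pi * I / 2 * N)) * thetaDiff (N + s) m τ z

lemma exp_two_pi_mul_nat (m r : ℕ) (x : ℂ) :
    exp (Real.pi * I / 2 * (4 * m * r) + x) = exp x := by
  have e : (Real.pi * I / 2 * (4 * m * r) + x : ℂ) =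
      x + ((m * r : ℕ) : ℂ) * (2 * Real.pi * I) := by push_cast; ring
  rw [e, exp_add, exp_nat_mul_two_pi_mul_I, mul_one]

/-- B collects N = 2mr + k and A collects N = 2m(r + 1) - k. The theta difference is odd and
2m-periodic in its index, so the reflected terms enter with the opposite sign and those with N ≡ m
mod 2m vanish. -/
lemma termA_sub_termB (hm : 1 ≤ m) (c : ℂ) (a : ℕ) (τ z : ℂ) (J : ℕ) :
    termA m c (m * a) τ z J - termB m c (m * a) τ z J =
      -∑ k ∈ Finset.range (m * J), oddTerm m c (m * a) τ z J (2 * k + 1) := by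
  have hm0 : (m : ℂ) ≠ 0 := by exact_mod_cast (by omega : m ≠ 0)
  have hG : ∀ r, Odd m → oddTerm m c (m * a) τ z J (2 * m * r + m) = 0 := by
    intro r _
    have e1 : (((2 * m * r + m : ℕ) : ℂ) + m * a) =
        -(((2 * m * r + m : ℕ) : ℂ) + m * a) + 2 * m * ((2 * r + 1 + a : ℤ) : ℂ) := by
      push_cast; ring
    have e2 : thetaDiff (((2 * m * r + m : ℕ) : ℂ) + m * a) m τ z = 0 := by
      have h := thetaDiff_add_period (-(((2 * m * r + m : ℕ) : ℂ) + m * a)) τ z hm0 (2 * r + 1 + a)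
      rw [← e1, thetaDiff_neg] at h
      linear_combination h / 2
    rw [oddTerm, e2, mul_zero]
  rw [sum_range_mul_odd m _ hG, termA, termB, sum_Icc_one_eq_sum_range, ← Finset.sum_sub_distrib,
    ← Finset.sum_neg_distrib]
  refine Finset.sum_congr rfl fun r _ => ?_
  rw [← Finset.sum_sub_distrib, ← Finset.sum_neg_distrib]
  refine Finset.sum_congr rfl fun k hk => ?_
  have hk' : k ≤ 2 * m * (r + 1) := by
    simp only [oddBelow, Finset.mem_filter, Finset.mem_Icc] at hk
    have : k ≤ m := by omega
    nlinarith [Nat.zero_le (m * r)]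
  have d1 : thetaDiff (2 * m * r + k + m * a) m τ z = thetaDiff (k + m * a) m τ z := by
    have h := thetaDiff_add_period (k + m * a) τ z hm0 r
    rw [← h]
    congr 1
    push_cast
    ring
  have d2 : thetaDiff (2 * m * (r + 1) - k + m * a) m τ z = -thetaDiff (k + m * a) m τ z := by
    have h := thetaDiff_add_period (-(k + m * a)) τ z hm0 (r + 1 + a)
    rw [← thetaDiff_neg, ← h]
    congr 1
    push_cast
    ring
  -- The two arguments differ by an integer multiple of 2πi.
  have p1 : exp (Real.pi * I / 2 * (2 * m * r - k)) = exp (-(Real.pi * I / 2 * (2 * m * r + k))) := by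
    rw [← exp_two_pi_mul_nat m r (-(Real.pi * I / 2 * (2 * m * r + k)))]
    congr 1
    ring
  have p2 : exp (Real.pi * I / 2 * (2 * m * (r + 1) + k)) =
      exp (-(Real.pi * I / 2 * (2 * m * (r + 1) - k))) := by
    rw [← exp_two_pi_mul_nat m (r + 1) (-(Real.pi * I / 2 * (2 * m * (r + 1) - k)))]
    congr 1
    push_cast
    ring
  rw [oddTerm, oddTerm, Nat.cast_sub hk']
  push_cast
  rw [d1, d2, p1, p2]
  ring

lemma exp_half_pi_mul_odd (k : ℕ) : exp (Real.pi * I / 2 * (2 * k + 1)) = I * (-1) ^ k := by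
  have e : (Real.pi * I / 2 * (2 * k + 1) : ℂ) = Real.pi / 2 * I + k * (Real.pi * I) := by ring
  rw [e, exp_add, exp_nat_mul, exp_pi_mul_I, exp_pi_div_two_mul_I]

lemma exp_neg_half_pi_mul_odd (k : ℕ) : exp (-(Real.pi * I / 2 * (2 * k + 1))) = -I * (-1) ^ k := by
  rw [exp_neg, exp_half_pi_mul_odd, mul_inv, inv_I, ← inv_pow]
  norm_num

/-- By `hc` the theta indices are ±(2k + 1 + ma) modulo 2m, and z ↦ -z interchanges them. The factor
i comes from exp(πi(2k + 1)/2) = i(-1)^k. -/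
lemma indefTerm_sub_neg (hm : 1 ≤ m) {c : ℂ} (a p : ℕ)
    (hc : (m / 2 - 2 * m * c : ℂ) = m * a - 2 * m * p) (τ z : ℂ) (J : ℕ) :
    I * (indefTerm m c τ z J - indefTerm m c τ (-z) J) =
      qPow τ (-(m / (m + 1)) * c ^ 2) *
        (termA m c (m * a) τ z J - termB m c (m * a) τ z J) := by
  have hm0 : (m : ℂ) ≠ 0 := by exact_mod_cast (by omega : m ≠ 0)
  rw [termA_sub_termB hm, indefTerm, indefTerm, ← Finset.sum_sub_distrib, Finset.mul_sum, mul_neg,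
    Finset.mul_sum, ← Finset.sum_neg_distrib]
  refine Finset.sum_congr rfl fun k _ => ?_
  have e1 : theta (m / 2 - 2 * m * c + (2 * k + 1)) m τ z =
      theta (2 * k + 1 + m * a) m τ z := by
    have h := theta_add_period (2 * k + 1 + m * a) τ z hm0 (-p)
    rw [← h, hc]
    congr 1
    push_cast
    ring
  have e2 : theta (-(m / 2 - 2 * m * c + (2 * k + 1))) m τ z =
      theta (-(2 * k + 1 + m * a)) m τ z := by
    have h := theta_add_period (-(2 * k + 1 + m * a)) τ z hm0 p
    rw [← h, hc]
    congr 1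
    push_cast
    ring
  have e3 : theta (m / 2 - 2 * m * c - (2 * k + 1)) m τ z =
      theta (-(2 * k + 1 + m * a)) m τ z := by
    have h := theta_add_period (-(2 * k + 1 + m * a)) τ z hm0 (a - p)
    rw [← h, hc]
    congr 1
    push_cast
    ring
  have e4 : theta (-(m / 2 - 2 * m * c - (2 * k + 1))) m τ z =
      theta (2 * k + 1 + m * a) m τ z := by
    have h := theta_add_period (2 * k + 1 + m * a) τ z hm0 (p - a)
    rw [← h, hc]
    congr 1
    push_cast
    ring
  have q1 : ∀ x : ℂ, qPow τ (-m * c ^ 2 / (m + 1) + J ^ 2 - (2 * k + 1) ^ 2 / (4 * m) + x) =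
      qPow τ (-(m / (m + 1)) * c ^ 2) * qPow τ (J ^ 2 - (2 * k + 1) ^ 2 / (4 * m)) * qPow τ x := by
    intro x
    rw [← qPow_add, ← qPow_add]
    congr 1
    ring
  rw [theta_neg, theta_neg, e1, e2, e3, e4, q1, q1, oddTerm, thetaDiff]
  push_cast
  rw [exp_half_pi_mul_odd, exp_neg_half_pi_mul_odd]
  ring

/-- The range 0 ≤ N ≤ 2mJ gives N²/(4m) ≤ JN, which the mixed term JN compensates. What remains of
the exponent is at least J² - 2m|c|J. -/
lemma norm_indefinite_le (hm : 1 ≤ m) (hτ : 0 < τ.im) (c N φ₁ φ₂ : ℝ) (J : ℕ) (hN0 : 0 ≤ N)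
    (hN : N ≤ 2 * m * J) (Δ : ℂ) :
    ‖(-1) ^ J * qPow τ (J ^ 2 - N ^ 2 / (4 * m)) *
      (qPow τ ((J + c) * N) * exp (Real.pi * I / 2 * φ₁) +
        qPow τ ((J - c) * N) * exp (Real.pi * I / 2 * φ₂)) * Δ‖ ≤
      2 * Real.exp (-(2 * Real.pi * τ.im * (J ^ 2 - 2 * m * |c| * J))) * ‖Δ‖ := by
  have hm' : (0 : ℝ) < m := by exact_mod_cast hm
  have hphase : ∀ φ : ℝ, ‖exp (Real.pi * I / 2 * φ)‖ = 1 := fun φ => by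
    have : (Real.pi * I / 2 * φ : ℂ) = ((Real.pi / 2 * φ : ℝ) : ℂ) * I := by push_cast; ring
    rw [this, norm_exp_ofReal_mul_I]
  have hpos : 0 ≤ 2 * Real.pi * τ.im := by have := Real.pi_pos; positivity
  have key : ∀ d : ℝ, |d| = |c| → ‖qPow τ (J ^ 2 - N ^ 2 / (4 * m)) * qPow τ ((J + d) * N)‖ ≤
      Real.exp (-(2 * Real.pi * τ.im * (J ^ 2 - 2 * m * |c| * J))) := by
    intro d hd
    have e : ((J : ℂ) ^ 2 - N ^ 2 / (4 * m) + (J + d) * N) =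
        (((J : ℝ) ^ 2 - N ^ 2 / (4 * m) + (J + d) * N : ℝ) : ℂ) := by push_cast; ring
    rw [← qPow_add, e, norm_qPow_ofReal, Real.exp_le_exp]
    apply neg_le_neg
    apply mul_le_mul_of_nonneg_left _ hpos
    have h1 : N ^ 2 / (4 * m) ≤ J * N := by
      rw [div_le_iff₀ (by positivity)]
      nlinarith [mul_nonneg (Nat.cast_nonneg (α := ℝ) J) hN0]
    have h2 : -(|c| * (2 * m * J)) ≤ d * N := by
      have h3 : -(|d| * N) ≤ d * N := by
        rw [← neg_mul]
        exact mul_le_mul_of_nonneg_right (neg_abs_le d) hN0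
      have h4 : |d| * N ≤ |c| * (2 * m * J) := by
        rw [hd]
        exact mul_le_mul_of_nonneg_left hN (abs_nonneg c)
      linarith
    nlinarith
  have k1 := key c rfl
  have k2 := key (-c) (abs_neg c)
  have e : (-1 : ℂ) ^ J * qPow τ (J ^ 2 - N ^ 2 / (4 * m)) *
      (qPow τ ((J + c) * N) * exp (Real.pi * I / 2 * φ₁) +
        qPow τ ((J - c) * N) * exp (Real.pi * I / 2 * φ₂)) * Δ =
      (-1) ^ J * (qPow τ (J ^ 2 - N ^ 2 / (4 * m)) * qPow τ ((J + c) * N) *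
        exp (Real.pi * I / 2 * φ₁) + qPow τ (J ^ 2 - N ^ 2 / (4 * m)) *
          qPow τ ((J + ((-c : ℝ) : ℂ)) * N) * exp (Real.pi * I / 2 * φ₂)) * Δ := by
    push_cast
    rw [← sub_eq_add_neg]
    ring
  rw [e, norm_mul, norm_mul, norm_pow, norm_neg, norm_one, one_pow, one_mul]
  refine mul_le_mul_of_nonneg_right ((norm_add_le _ _).trans ?_) (norm_nonneg _)
  rw [norm_mul _ (exp _), norm_mul _ (exp _), hphase, hphase]
  linarith

/-- The factor J, which counts the values of r, is absorbed by J ≤ e^J into the linear part of the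
exponent. -/
lemma summable_mul_exp_quadratic (m : ℕ) (hτ : 0 < τ.im) (c B : ℝ) :
    Summable fun J : ℕ => (J : ℝ) *
      (2 * Real.exp (-(2 * Real.pi * τ.im * (J ^ 2 - 2 * m * |c| * J))) * B) := by
  have hpi := Real.pi_pos
  have hr : ((-(2 * Real.pi * τ.im) : ℝ) : ℂ).re < 0 := by
    rw [ofReal_re]
    have : 0 < 2 * Real.pi * τ.im := by positivity
    linarith
  have h := (summable_exp_quadratic hr (2 * Real.pi * τ.im * (2 * m * |c|) + 1 : ℝ) 0).norm
  have h2 := (h.comp_injective (fun a b hab => by simpa using hab :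
    Function.Injective fun n : ℕ => (n : ℤ))).mul_right (2 * |B|)
  refine Summable.of_norm_bounded h2 fun J => ?_
  have e : ((-(2 * Real.pi * τ.im) : ℝ) : ℂ) * (((J : ℕ) : ℤ) : ℂ) ^ 2 +
      ((2 * Real.pi * τ.im * (2 * m * |c|) + 1 : ℝ) : ℂ) * (((J : ℕ) : ℤ) : ℂ) + 0 =
      ((-(2 * Real.pi * τ.im * (J ^ 2 - 2 * m * |c| * J)) + J : ℝ) : ℂ) := by
    push_cast
    ring
  rw [Function.comp_apply, e, norm_exp, ofReal_re, Real.exp_add, norm_mul, norm_mul, norm_mul,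
    Real.norm_eq_abs, Real.norm_eq_abs, Real.norm_eq_abs, Real.norm_eq_abs, abs_of_nonneg
    (Nat.cast_nonneg J), abs_of_pos (Real.exp_pos _), abs_of_pos (by norm_num : (0 : ℝ) < 2)]
  have hJ : (J : ℝ) ≤ Real.exp J := (by linarith [Real.add_one_le_exp (J : ℝ)])
  calc _ = (J : ℝ) * (Real.exp (-(2 * Real.pi * τ.im * (J ^ 2 - 2 * m * |c| * J))) * (2 * |B|)) := by
        ring
    _ ≤ Real.exp J *
        (Real.exp (-(2 * Real.pi * τ.im * (J ^ 2 - 2 * m * |c| * J))) * (2 * |B|)) := by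
        gcongr
    _ = _ := by ring

lemma summable_of_double_sum_bound (hτ : 0 < τ.im) (c : ℝ) {f : ℕ → ℂ}
    {s : ℕ → Finset ℕ} (hs : ∀ J, (s J).card = J) {t : Finset ℕ} {F : ℕ → ℕ → ℕ → ℂ} {Δ : ℕ → ℂ}
    (hf : ∀ J, f J = ∑ r ∈ s J, ∑ k ∈ t, F J r k)
    (hF : ∀ J, ∀ r ∈ s J, ∀ k ∈ t, ‖F J r k‖ ≤
      2 * Real.exp (-(2 * Real.pi * τ.im * (J ^ 2 - 2 * m * |c| * J))) * ‖Δ k‖) :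
    Summable f := by
  refine Summable.of_norm_bounded (summable_mul_exp_quadratic m hτ c (∑ k ∈ t, ‖Δ k‖))
    fun J => ?_
  rw [hf J]
  have h : ∀ r ∈ s J, ‖∑ k ∈ t, F J r k‖ ≤
      2 * Real.exp (-(2 * Real.pi * τ.im * (J ^ 2 - 2 * m * |c| * J))) * ∑ k ∈ t, ‖Δ k‖ := by
    intro r hr
    rw [Finset.mul_sum]
    exact (norm_sum_le _ _).trans (Finset.sum_le_sum fun k hk => hF J r hr k hk)
  refine (norm_sum_le _ _).trans ((Finset.sum_le_sum h).trans ?_)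
  rw [Finset.sum_const, hs J, nsmul_eq_mul]

lemma summable_termA (hm : 1 ≤ m) (hτ : 0 < τ.im) (c : ℝ) (s z : ℂ) :
    Summable (termA m c s τ z) := by
  refine summable_of_double_sum_bound (m := m) hτ c (s := fun J => Finset.Icc 1 J) (by simp)
    (fun J => rfl) (Δ := fun k => thetaDiff (k + s) m τ z) fun J r hr k hk => ?_
  simp only [oddBelow, Finset.mem_filter, Finset.mem_Icc] at hr hk
  have h1 : (1 : ℝ) ≤ r := by exact_mod_cast hr.1
  have h2 : (r : ℝ) ≤ J := by exact_mod_cast hr.2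
  have h3 : (k : ℝ) ≤ m := by exact_mod_cast (by omega : k ≤ m)
  have h4 : (0 : ℝ) ≤ k := Nat.cast_nonneg k
  have h := norm_indefinite_le hm hτ c (2 * m * r - k) (2 * m * r + k) (2 * m * r - k) J
    (by nlinarith) (by nlinarith) (thetaDiff (k + s) m τ z)
  push_cast at h
  exact h

lemma summable_termB (hm : 1 ≤ m) (hτ : 0 < τ.im) (c : ℝ) (s z : ℂ) :
    Summable (termB m c s τ z) := by
  refine summable_of_double_sum_bound (m := m) hτ c (s := fun J => Finset.range J) (by simp)
    (fun J => rfl) (Δ := fun k => thetaDiff (k + s) m τ z) fun J r hr k hk => ?_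
  simp only [oddBelow, Finset.mem_filter, Finset.mem_Icc, Finset.mem_range] at hr hk
  have h2 : (r : ℝ) + 1 ≤ J := by exact_mod_cast hr
  have h3 : (k : ℝ) ≤ m := by exact_mod_cast (by omega : k ≤ m)
  have h4 : (0 : ℝ) ≤ k := Nat.cast_nonneg k
  have h5 : (0 : ℝ) ≤ r := Nat.cast_nonneg r
  have h := norm_indefinite_le hm hτ c (2 * m * r + k) (2 * m * r - k) (2 * m * r + k) J
    (by positivity) (by nlinarith) (thetaDiff (k + s) m τ z)
  push_cast at h
  exact h

/-! ### The modified expansion of the antisymmetrized Appell-Lerch series -/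

/-- The expansion at -z is subtracted from the one at z and the result divided by D. The integers a
and p record the periods by which the theta indices are normalized. -/
theorem lerchDiff_eq (hm : 1 ≤ m) (hτ : 0 < τ.im) (h : ∀ j, 1 + rho τ z j ≠ 0)
    (h' : ∀ j, 1 + rho τ (-z) j ≠ 0) {c k K s : ℂ} (cr : ℝ) (hcr : c = cr) (a p : ℕ)
    (hs : s = m * a) (hc : (m / 2 - 2 * m * c : ℂ) = m * a - 2 * m * p)
    (hK : ((m + 1) / 2 - 2 * m * c : ℂ) = K - 2 * (m + 1) * p) (hk : k = 2 * m * c)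
    (hD : signedTheta (paritySign m) k (m + 1) τ 0 ≠ 0) :
    lerchDiff m (m * c - 1 / 2) τ z =
      (ModularForm.eta (2 * τ) ^ 3 / signedTheta (paritySign m) k (m + 1) τ 0) *
        (theta K (m + 1) τ z / theta (-1 / 2) 1 τ z -
          theta (-K) (m + 1) τ z / theta (1 / 2) 1 τ z) +
      I * (qPow τ (-(m / (m + 1)) * c ^ 2) / signedTheta (paritySign m) k (m + 1) τ 0) *
        ∑' n : ℕ, termA m c s τ z (n + 1) -
      I * (qPow τ (-(m / (m + 1)) * c ^ 2) / signedTheta (paritySign m) k (m + 1) τ 0) *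
        ∑' n : ℕ, termB m c s τ z (n + 1) := by
  have hM : (m + 1 : ℂ) ≠ 0 := by exact_mod_cast Nat.succ_ne_zero m
  obtain ⟨s1, e1⟩ := quot_eq_lerchSum_add hm hτ c h
  obtain ⟨s2, e2⟩ := quot_eq_lerchSum_add hm hτ c h'
  have sA : Summable fun n : ℕ => termA m c s τ z (n + 1) := by
    rw [hcr]
    exact (summable_nat_add_iff 1).mpr (summable_termA hm hτ cr s z)
  have sB : Summable fun n : ℕ => termB m c s τ z (n + 1) := by
    rw [hcr]
    exact (summable_nat_add_iff 1).mpr (summable_termB hm hτ cr s z)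
  have key : I * (∑' n : ℕ, indefTerm m c τ z (n + 1) - ∑' n : ℕ, indefTerm m c τ (-z) (n + 1)) =
      qPow τ (-(m / (m + 1)) * c ^ 2) *
        (∑' n : ℕ, termA m c s τ z (n + 1) - ∑' n : ℕ, termB m c s τ z (n + 1)) := by
    rw [← s1.tsum_sub s2, ← sA.tsum_sub sB, ← tsum_mul_left, ← tsum_mul_left]
    refine tsum_congr fun n => ?_
    rw [hs]
    exact indefTerm_sub_neg hm a p hc τ z (n + 1)
  have eK : ∀ x, theta ((m + 1) / 2 - 2 * m * c) (m + 1) τ x = theta K (m + 1) τ x := by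
    intro x
    have h1 := theta_add_period K τ x hM (-p)
    rw [← h1, hK]
    congr 1
    push_cast
    ring
  have e3 : theta (-1 / 2) 1 τ (-z) = theta (1 / 2) 1 τ z := by
    rw [theta_neg]
    congr 1
    ring
  rw [eK, tsum_lerchCoeff, ← hk] at e1 e2
  rw [e3, theta_neg] at e2
  rw [lerchDiff]
  generalize signedTheta (paritySign m) k (m + 1) τ 0 = D at *
  apply mul_left_cancel₀ hD
  have e4 : ∀ x y : ℂ, D * (x / D * y) = x * y := fun x y => by field_simp
  have e5 : ∀ x y : ℂ, D * (I * (x / D) * y) = I * (x * y) := fun x y => by field_simp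
  rw [mul_sub, mul_sub, mul_add, e4, e5, e5]
  linear_combination e2 - e1 + I * key -
    (∑' n : ℕ, indefTerm m c τ z (n + 1) - ∑' n : ℕ, indefTerm m c τ (-z) (n + 1)) * I_sq

lemma exp_neg_pi_mul_half : exp (-(Real.pi * I * (1 / 2))) = -I := by
  have := exp_neg_half_pi_mul_odd 0
  rw [pow_zero, mul_one] at this
  rw [← this]
  congr 1
  push_cast
  ring

lemma lerchDiff_quarter_sub_half (hm : 1 ≤ m) (hτ : 0 < τ.im) (h : ∀ j, 1 + rho τ z j ≠ 0)
    (h' : ∀ j, 1 + rho τ (-z) j ≠ 0) (p : ℕ) :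
    lerchDiff m (m / 4 - 1 / 2) τ z =
      (-1) ^ (m * p) * lerchDiff m (m * (p + 1 / 4) - 1 / 2) τ z +
      ∑ k ∈ Finset.Icc 1 (p * m), (-1) ^ k * qPow τ (-(1 / m) * (k - 1 / 2 + m / 4) ^ 2) *
        thetaDiff (2 * k - 1) m τ z := by
  rw [lerchDiff_add_natCast hm hτ h h' _ (p * m), sub_eq_add_neg, ← Finset.sum_neg_distrib,
    mul_comm p m]
  congr 1
  · congr 2
    push_cast
    ring
  · refine Finset.sum_congr rfl fun k _ => ?_
    have e : (m / 2 - 2 * (m / 4 - 1 / 2 + k) : ℂ) = -(2 * k - 1) := by ring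
    rw [e, thetaDiff_neg]
    have e2 : -(m / 4 - 1 / 2 + k : ℂ) ^ 2 / m = -(1 / m) * (k - 1 / 2 + m / 4) ^ 2 := by ring
    rw [e2]
    ring

lemma lerchDiff_quarter (hm : 1 ≤ m) (hτ : 0 < τ.im) (h : ∀ j, 1 + rho τ z j ≠ 0)
    (h' : ∀ j, 1 + rho τ (-z) j ≠ 0) (p : ℕ) :
    lerchDiff m (m / 4) τ z =
      (-1) ^ (m * p) * lerchDiff m (m / 4 + m * p) τ z +
      ∑ k ∈ Finset.Icc 1 (p * m), (-1) ^ k * qPow τ (-(1 / m) * (k + m / 4) ^ 2) *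
        thetaDiff (2 * k) m τ z := by
  rw [lerchDiff_add_natCast hm hτ h h' _ (p * m), sub_eq_add_neg, ← Finset.sum_neg_distrib,
    mul_comm p m]
  congr 1
  · congr 2
    push_cast
    ring
  · refine Finset.sum_congr rfl fun k _ => ?_
    have e : (m / 2 - 2 * (m / 4 + k) : ℂ) = -(2 * k) := by ring
    rw [e, thetaDiff_neg]
    have e2 : -(m / 4 + k : ℂ) ^ 2 / m = -(1 / m) * (k + m / 4) ^ 2 := by ring
    rw [e2]
    ring

/-- The two parameters differ by (m + 1)/2 = n + 1, an integer because m is odd. Of the n + 1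
correction terms, the last has theta index 0 modulo 2m and drops out. -/
lemma lerchDiff_quarter_add_of_odd {n : ℕ} (hmn : m = 2 * n + 1) (hτ : 0 < τ.im)
    (h : ∀ j, 1 + rho τ z j ≠ 0) (h' : ∀ j, 1 + rho τ (-z) j ≠ 0) (p : ℕ) :
    lerchDiff m (m / 4 + m * p) τ z =
      -(-1) ^ n * lerchDiff m (m * (p - 1 / 4) - 1 / 2) τ z +
      ∑ k ∈ Finset.Icc 1 n, (-1) ^ k * qPow τ (-m * (p + 1 / 4 - k / m) ^ 2) *
        thetaDiff (2 * k) m τ z := by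
  have hm : 1 ≤ m := by omega
  have hm0 : (m : ℂ) ≠ 0 := by exact_mod_cast (by omega : m ≠ 0)
  have hmc : (m : ℂ) = 2 * n + 1 := by exact_mod_cast hmn
  have hsign : ((-1 : ℂ) ^ n) * (-1) ^ n = 1 := by rw [← mul_pow]; simp
  have hb : (m * (p - 1 / 4) - 1 / 2 + ((n + 1 : ℕ) : ℂ) : ℂ) = m / 4 + m * p := by
    push_cast
    linear_combination -hmc / 2
  have hΔ : ∀ k : ℕ, thetaDiff (m / 2 - 2 * (m / 4 + m * p - k)) m τ z =
      thetaDiff (2 * k) m τ z := by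
    intro k
    have h1 := thetaDiff_add_period (2 * k) τ z hm0 (-p)
    rw [← h1]
    congr 1
    push_cast
    ring
  have h1 := lerchDiff_add_natCast hm hτ h h' (m * (p - 1 / 4) - 1 / 2) (n + 1)
  -- Reversing the sum counts the corrections down from b = m/4 + mp; the index 0 split off is the
  -- vanishing one.
  rw [hb, sum_Icc_one_eq_sum_range, ← Finset.sum_range_reflect, Finset.sum_range_succ'] at h1
  have h2 : thetaDiff (2 * (0 : ℕ)) m τ z = 0 := by simp [thetaDiff]
  have h3 : ∀ k ∈ Finset.range n, (-1 : ℂ) ^ (n + 1 - 1 - (k + 1) + 1) *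
      qPow τ (-(m * (p - 1 / 4) - 1 / 2 + ((n + 1 - 1 - (k + 1) + 1 : ℕ) : ℂ)) ^ 2 / m) *
      thetaDiff (m / 2 - 2 * (m * (p - 1 / 4) - 1 / 2 + ((n + 1 - 1 - (k + 1) + 1 : ℕ) : ℂ))) m τ z =
      -(-1) ^ n * ((-1) ^ (k + 1) * qPow τ (-m * (p + 1 / 4 - ((k + 1 : ℕ) : ℂ) / m) ^ 2) *
        thetaDiff (2 * ((k + 1 : ℕ) : ℂ)) m τ z) := by
    intro k hk
    have hk' : k < n := Finset.mem_range.mp hk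
    have ek : n + 1 - 1 - (k + 1) + 1 = n - k := by omega
    have ec : ((n - k : ℕ) : ℂ) = n - k := Nat.cast_sub hk'.le
    have eb : (m * (p - 1 / 4) - 1 / 2 + ((n - k : ℕ) : ℂ) : ℂ) =
        m / 4 + m * p - ((k + 1 : ℕ) : ℂ) := by
      rw [ec, ← hb]
      push_cast
      ring
    have es : (-1 : ℂ) ^ (n - k) = (-1) ^ n * (-1) ^ k := by
      have : (-1 : ℂ) ^ n = (-1) ^ (n - k) * (-1) ^ k := by
        rw [← pow_add]; congr 1; omega
      have hk2 : ((-1 : ℂ) ^ k) * (-1) ^ k = 1 := by rw [← mul_pow]; simp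
      rw [this, mul_assoc, hk2, mul_one]
    have eq : -(m / 4 + m * p - ((k + 1 : ℕ) : ℂ)) ^ 2 / m =
        -m * (p + 1 / 4 - ((k + 1 : ℕ) : ℂ) / m) ^ 2 := by
      field_simp
      ring
    rw [ek, eb, hΔ, es, eq]
    ring
  have h4 : thetaDiff (m / 2 - 2 * (m * (p - 1 / 4) - 1 / 2 + ((n + 1 - 1 - 0 + 1 : ℕ) : ℂ))) m τ z
      = 0 := by
    have : (m * (p - 1 / 4) - 1 / 2 + ((n + 1 - 1 - 0 + 1 : ℕ) : ℂ) : ℂ) =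
        m / 4 + m * p - (0 : ℕ) := by
      rw [← hb]
      simp
    rw [this, hΔ, h2]
  rw [Finset.sum_congr rfl h3, h4, mul_zero, add_zero, ← Finset.mul_sum,
    ← sum_Icc_one_eq_sum_range fun k => (-1) ^ k * qPow τ (-m * (p + 1 / 4 - (k : ℂ) / m) ^ 2) *
        thetaDiff (2 * (k : ℂ)) m τ z, pow_succ] at h1
  linear_combination (-1) ^ n * h1 - (lerchDiff m (m / 4 + m * p) τ z -
    ∑ k ∈ Finset.Icc 1 n, (-1) ^ k * qPow τ (-m * (p + 1 / 4 - (k : ℂ) / m) ^ 2) *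
        thetaDiff (2 * (k : ℂ)) m τ z) * hsign

lemma signedTheta_ne_zero_of_odd (hτ : 0 < τ.im) (ho : Odd m) (x : ℝ) :
    signedTheta (paritySign m) x (m + 1) τ 0 ≠ 0 := by
  have h := theta_constant_ne_zero hτ x (M := m + 1) (by omega)
  rw [paritySign, if_pos ho]
  push_cast at h
  exact h

end MockTheta

end

/-! ### Proof of the proposition -/

open MockTheta Complex in
theorem mainTheorem5 (m p : ℕ) (hm : 1 ≤ m) (τ z : ℂ) (hτ : 0 < τ.im)
    (hz₁ : ∀ a b : ℤ, z + τ / 2 - 1 / 2 ≠ a + b * (2 * τ))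
    (hz₂ : ∀ a b : ℤ, z - τ / 2 + 1 / 2 ≠ a + b * (2 * τ)) :
    -- part 1
    (Summable (fun n : ℕ => termA m (p + 1 / 4) 0 τ z (n + 1)) ∧
      Summable (fun n : ℕ => termB m (p + 1 / 4) 0 τ z (n + 1)) ∧
      -- for even `m` the denominator can vanish identically; for odd `m` it never vanishes
      ((Even m → signedTheta (-1) (m * (2 * p + 1 / 2)) (m + 1) τ 0 ≠ 0) →
        Phi (m / 2) (1 / 2) (2 * τ) (z + τ / 2 - 1 / 2) (z - τ / 2 + 1 / 2) (τ / 8) =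
          -I * (-1) ^ (m * p) *
              (ModularForm.eta (2 * τ) ^ 3 /
                signedTheta (paritySign m) (m * (2 * p + 1 / 2)) (m + 1) τ 0) *
              (theta (2 * p + 1 / 2) (m + 1) τ z / theta (-1 / 2) 1 τ z -
                theta (-2 * p - 1 / 2) (m + 1) τ z / theta (1 / 2) 1 τ z)
          + (-1) ^ (m * p) *
              (qPow τ (-(m / (m + 1)) * (p + 1 / 4) ^ 2) /
                signedTheta (paritySign m) (m * (2 * p + 1 / 2)) (m + 1) τ 0) *
              ∑' n : ℕ, termA m (p + 1 / 4) 0 τ z (n + 1)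
          - (-1) ^ (m * p) *
              (qPow τ (-(m / (m + 1)) * (p + 1 / 4) ^ 2) /
                signedTheta (paritySign m) (m * (2 * p + 1 / 2)) (m + 1) τ 0) *
              ∑' n : ℕ, termB m (p + 1 / 4) 0 τ z (n + 1)
          - I * ∑ k ∈ Finset.Icc 1 (p * m),
              (-1) ^ k * qPow τ (-(1 / m) * (k - 1 / 2 + m / 4) ^ 2) *
                thetaDiff (2 * k - 1) m τ z)) ∧
    -- part 2
    (Odd m →
      Summable (fun n : ℕ => termA m (p - 1 / 4) m τ z (n + 1)) ∧
      Summable (fun n : ℕ => termB m (p - 1 / 4) m τ z (n + 1)) ∧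
      Phi (m / 2) 0 (2 * τ) (z + τ / 2 - 1 / 2) (z - τ / 2 + 1 / 2) (τ / 8) =
        -I * (-1) ^ (m * p) * exp (-(Real.pi * I * m / 2)) *
            (ModularForm.eta (2 * τ) ^ 3 / theta (m * (2 * p - 1 / 2)) (m + 1) τ 0) *
            (theta (2 * p - 1 / 2 + m + 1) (m + 1) τ z / theta (-1 / 2) 1 τ z -
              theta (-(2 * p - 1 / 2 + m + 1)) (m + 1) τ z / theta (1 / 2) 1 τ z)
        + (-1) ^ (m * p) * exp (-(Real.pi * I * m / 2)) *
            (qPow τ (-(m / (m + 1)) * (p - 1 / 4) ^ 2) /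
              theta (m * (2 * p - 1 / 2)) (m + 1) τ 0) *
            ∑' n : ℕ, termA m (p - 1 / 4) m τ z (n + 1)
        - (-1) ^ (m * p) * exp (-(Real.pi * I * m / 2)) *
            (qPow τ (-(m / (m + 1)) * (p - 1 / 4) ^ 2) /
              theta (m * (2 * p - 1 / 2)) (m + 1) τ 0) *
            ∑' n : ℕ, termB m (p - 1 / 4) m τ z (n + 1)
        + (-1) ^ (m * p) * ∑ k ∈ Finset.Icc 1 ((m - 1) / 2),
            (-1) ^ k * qPow τ (-m * (p + 1 / 4 - k / m) ^ 2) * thetaDiff (2 * k) m τ z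
        + ∑ k ∈ Finset.Icc 1 (p * m),
            (-1) ^ k * qPow τ (-(1 / m) * (k + m / 4) ^ 2) * thetaDiff (2 * k) m τ z) := by

  have h : ∀ j, 1 + rho τ z j ≠ 0 := one_add_rho_ne_zero hz₁
  have h' : ∀ j, 1 + rho τ (-z) j ≠ 0 := by
    refine one_add_rho_ne_zero fun a b hab => hz₂ (-a) (-b) ?_
    push_cast
    linear_combination -hab
  have hm0 : (m : ℂ) ≠ 0 := by exact_mod_cast (by omega : m ≠ 0)
  have c1 : ((p : ℂ) + 1 / 4) = ((p + 1 / 4 : ℝ) : ℂ) := by push_cast; ring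
  have c2 : ((p : ℂ) - 1 / 4) = ((p - 1 / 4 : ℝ) : ℂ) := by push_cast; ring
  refine ⟨⟨?_, ?_, fun hD => ?_⟩, fun ho => ⟨?_, ?_, ?_⟩⟩
  · rw [c1]
    exact (summable_nat_add_iff 1).mpr (summable_termA hm hτ _ _ z)
  · rw [c1]
    exact (summable_nat_add_iff 1).mpr (summable_termB hm hτ _ _ z)
  · have hD' : signedTheta (paritySign m) (m * (2 * p + 1 / 2)) (m + 1) τ 0 ≠ 0 := by
      rcases Nat.even_or_odd m with he | ho
      · rw [paritySign, if_neg (Nat.not_odd_iff_even.mpr he)]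
        exact hD he
      · have := signedTheta_ne_zero_of_odd hτ ho (m * (2 * p + 1 / 2))
        push_cast at this
        exact this
    -- For c = p + 1/4, m/2 - 2mc = -2mp is a multiple of the period 2m, so a = 0.
    have e := lerchDiff_eq hm hτ h h' (c := p + 1 / 4) (k := m * (2 * p + 1 / 2))
      (K := 2 * p + 1 / 2) (s := 0) _ c1 0 p (by simp) (by push_cast; ring) (by ring) (by ring) hD'
    have eK : (-2 * p - 1 / 2 : ℂ) = -(2 * p + 1 / 2) := by ring
    rw [Phi_eq_lerchDiff, exp_neg_pi_mul_half, lerchDiff_quarter_sub_half hm hτ h h' p, e, eK]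
    generalize qPow τ (-(m / (m + 1)) * (p + 1 / 4) ^ 2) /
      signedTheta (paritySign m) (m * (2 * p + 1 / 2)) (m + 1) τ 0 = q
    linear_combination (-(-1) ^ (m * p) * q * (∑' n : ℕ, termA m (p + 1 / 4) 0 τ z (n + 1) -
      ∑' n : ℕ, termB m (p + 1 / 4) 0 τ z (n + 1))) * I_sq
  · rw [c2]
    exact (summable_nat_add_iff 1).mpr (summable_termA hm hτ _ _ z)
  · rw [c2]
    exact (summable_nat_add_iff 1).mpr (summable_termB hm hτ _ _ z)
  · obtain ⟨n, hn⟩ := ho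
    have hmc : (m : ℂ) = 2 * n + 1 := by exact_mod_cast hn
    have hD' : signedTheta (paritySign m) (m * (2 * p - 1 / 2)) (m + 1) τ 0 ≠ 0 := by
      have := signedTheta_ne_zero_of_odd hτ ⟨n, hn⟩ (m * (2 * p - 1 / 2))
      push_cast at this
      exact this
    -- For c = p - 1/4, m/2 - 2mc = m - 2mp, so a = 1 and the theta indices are shifted by m.
    have e := lerchDiff_eq hm hτ h h' (c := p - 1 / 4) (k := m * (2 * p - 1 / 2))
      (K := 2 * p - 1 / 2 + m + 1) (s := m) _ c2 1 p (by simp) (by push_cast; ring) (by ring)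
      (by ring) hD'
    have eD : signedTheta (paritySign m) (m * (2 * p - 1 / 2)) (m + 1) τ 0 =
        theta (m * (2 * p - 1 / 2)) (m + 1) τ 0 := by
      rw [paritySign, if_pos ⟨n, hn⟩, theta]
    -- This phase encodes the sign -(-1)^n of the n + 1 shifts, since -i · (-i)(-1)^n = -(-1)^n.
    have eexp : exp (-(Real.pi * I * m / 2)) = -I * (-1) ^ n := by
      rw [← exp_neg_half_pi_mul_odd, hmc]
      congr 1
      ring
    have e0 : (m / 4 - 0 : ℂ) = m / 4 := sub_zero _
    have en : (m - 1) / 2 = n := by omega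
    rw [Phi_eq_lerchDiff, mul_zero, neg_zero, exp_zero, one_mul, e0,
      lerchDiff_quarter hm hτ h h' p, lerchDiff_quarter_add_of_odd hn hτ h h' p, e, eD, eexp, en]
    linear_combination -(-1) ^ (m * p) * (-1) ^ n *
      (ModularForm.eta (2 * τ) ^ 3 / theta (m * (2 * p - 1 / 2)) (m + 1) τ 0) *
      (theta (2 * p - 1 / 2 + m + 1) (m + 1) τ z / theta (-1 / 2) 1 τ z -
          theta (-(2 * p - 1 / 2 + m + 1)) (m + 1) τ z / theta (1 / 2) 1 τ z) * I_sq
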